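/- Let $n\ge m+1\ge 3$ be integers and write $ds^2_{n-1}$, $ds^2_m$ for the round metrics of the unit spheres $S^{n-1}$, $S^m$. Fix $R'\in(0,\tfrac14)$. There is a function $c\mapsto\delta(c)$, depending only on $R'$, with the following property. Let $a>\tfrac12$ and $k,\alpha>0$, let $D^n$ be the disc with polar coordinate $r\in[0,a]$, and let $h,f:[0,a]\to\mathbb R$ be smooth functions such that - $h(r)=\sin r$ for $r\in[0,R']$, and $h''\le 0$, $h'\ge 0$ on $[0,a]$; - $f\equiv 1$ on $[0,\tfrac14]$, and $f'\ge 0$ on $[0,a]$; - the metric $G=dr^2+h^2(r)\,ds^2_{n-1}+k^2(f(r)+\alpha)^2\,ds^2_m$ on $D^n\times S^m$ has positive scalar curvature. Then there is $c_0>0$ such that for every $c\in(0,c_0)$ one has $0<\delta(c)<R'$, and there are a smooth concave function $h_\infty$ with $$h_\infty(r)=\sin r\ \text{ for } r\in[0,\delta(c)],\qquad h_\infty(r)= c\ \text{ for } r>R',$$ and a smooth path $(G_\tau)_{\tau\in[0,1]}$ of Riemannian metrics of positive scalar curvature on $D^n\times S^m$ with $$G_0=G,\qquad G_1=dr^2+h_\infty^2(r)\,ds^2_{n-1}+k^2(f(r)+\alpha)^2\,ds^2_m,$$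 and such that $G_\tau=G$ at all points with $r\le\delta(c)$, for all $\tau\in[0,1]$. -/

import Mathlib

set_option maxSynthPendingDepth 3

open Set Metric Module
open scoped Manifold ContDiff RealInnerProductSpace

noncomputable section

namespace PSC

/-! ### Curvature of a metric given in coordinates on a finite-dimensional vector space -/

section Coordinates

variable {E : Type*} [NormedAddCommGroup E] [NormedSpace ℝ E]

/-- Christoffel symbols of the first kind:
`(v, w, z) ↦ (∂_v g(w, z) + ∂_w g(v, z) - ∂_z g(v, w)) / 2`. -/
def christoffelLower (g : E → E →L[ℝ] E →L[ℝ] ℝ) (x : E) : E →L[ℝ] E →L[ℝ] E →L[ℝ] ℝ :=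
  (1 / 2 : ℝ) • (fderiv ℝ g x + (fderiv ℝ g x).flip -
    ((ContinuousLinearMap.flipₗᵢ ℝ E E ℝ).toContinuousLinearEquiv :
      (E →L[ℝ] E →L[ℝ] ℝ) →L[ℝ] (E →L[ℝ] E →L[ℝ] ℝ)) ∘L (fderiv ℝ g x).flip)

theorem christoffelLower_apply (g : E → E →L[ℝ] E →L[ℝ] ℝ) (x v w z : E) :
    christoffelLower g x v w z =
      1 / 2 * (fderiv ℝ g x v w z + fderiv ℝ g x w v z - fderiv ℝ g x z v w) := by
  simp [christoffelLower]

/-- Christoffel symbols of the second kind: `Γ(v, w)` is the vector which is dual, with respect to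
`g`, to the functional `christoffelLower g x v w`. -/
def christoffel (g : E → E →L[ℝ] E →L[ℝ] ℝ) (x : E) : E →L[ℝ] E →L[ℝ] E :=
  ContinuousLinearMap.compL ℝ E (E →L[ℝ] ℝ) E (g x).inverse ∘L christoffelLower g x

/-- The curvature tensor `u ↦ R(u, v) w`, where
`R(u, v) w = (∂_u Γ)(v, w) - (∂_v Γ)(u, w) + Γ(u, Γ(v, w)) - Γ(v, Γ(u, w))`. -/
def curvature (g : E → E →L[ℝ] E →L[ℝ] ℝ) (x v w : E) : E →L[ℝ] E :=
  ((fderiv ℝ (christoffel g) x).flip v).flip w - (fderiv ℝ (christoffel g) x v).flip w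
    + (christoffel g x).flip (christoffel g x v w)
    - (christoffel g x v) ∘L (christoffel g x).flip w

theorem curvature_apply (g : E → E →L[ℝ] E →L[ℝ] ℝ) (x u v w : E) :
    curvature g x v w u =
      fderiv ℝ (christoffel g) x u v w - fderiv ℝ (christoffel g) x v u w
        + christoffel g x u (christoffel g x v w)
        - christoffel g x v (christoffel g x u w) := by
  simp [curvature]

/-- The Ricci tensor `Ric(v, w) = trace (u ↦ R(u, v) w)`. -/
def ricci (g : E → E →L[ℝ] E →L[ℝ] ℝ) (x : E) : E →ₗ[ℝ] E →ₗ[ℝ] ℝ :=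
  LinearMap.mk₂ ℝ (fun v w => LinearMap.trace ℝ E (curvature g x v w : E →ₗ[ℝ] E))
    (fun v v' w => by
      rw [← map_add]; congr 1; ext u; simp [curvature_apply]; abel)
    (fun t v w => by
      rw [← map_smul]; congr 1; ext u; simp [curvature_apply, smul_sub, smul_add])
    (fun v w w' => by
      rw [← map_add]; congr 1; ext u; simp [curvature_apply]; abel)
    (fun t v w => by
      rw [← map_smul]; congr 1; ext u; simp [curvature_apply, smul_sub, smul_add])

variable [FiniteDimensional ℝ E]

/-- The scalar curvature in coordinates: the trace of the Ricci tensor with respect to `g`. -/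
def coordScalarCurvature (g : E → E →L[ℝ] E →L[ℝ] ℝ) (x : E) : ℝ :=
  LinearMap.trace ℝ E
    (((g x).inverse : (E →L[ℝ] ℝ) →ₗ[ℝ] E) ∘ₗ
      (LinearMap.toContinuousLinearMap : (E →ₗ[ℝ] ℝ) ≃ₗ[ℝ] (E →L[ℝ] ℝ)).toLinearMap ∘ₗ
      ricci g x)

end Coordinates

/-! ### Metrics on manifolds -/

section Manifolds

variable {E : Type*} [NormedAddCommGroup E] [NormedSpace ℝ E]
  {H : Type*} [TopologicalSpace H] (I : ModelWithCorners ℝ E H)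
  (M : Type*) [TopologicalSpace M] [ChartedSpace H M]

/-- A covariant 2-tensor field on `M` (no regularity or positivity is required here). -/
abbrev TwoTensor : Type _ :=
  (p : M) → TangentSpace I p →L[ℝ] TangentSpace I p →L[ℝ] ℝ

variable {I M}

/-- The expression of a 2-tensor field in the chart at `p`, i.e. its pull-back under the inverse of
this chart. -/
def inChart (g : TwoTensor I M) (p : M) (z : E) : E →L[ℝ] E →L[ℝ] ℝ :=
  let B : E →L[ℝ] E →L[ℝ] ℝ := g ((extChartAt I p).symm z)
  let L : E →L[ℝ] E := mfderiv 𝓘(ℝ, E) I (extChartAt I p).symm z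
  B.bilinearComp L L

/-- The scalar curvature at `p` of a metric on a manifold without boundary, computed in the chart
at `p`. -/
def scalarCurvature [FiniteDimensional ℝ E] [BoundarylessManifold I M]
    (g : TwoTensor I M) (p : M) : ℝ :=
  coordScalarCurvature (inChart g p) (extChartAt I p p)

/-- `γ τ`, `τ ∈ [0, 1]`, is a smooth path of Riemannian metrics of positive scalar curvature on the
subset `K` of `M` (smoothness is joint in `τ` and the point, and up to the boundary of `K`). -/
structure IsSmoothPSCPathOn [FiniteDimensional ℝ E] [BoundarylessManifold I M]
    (γ : ℝ → TwoTensor I M) (K : Set M) : Prop where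
  smooth : ∀ τ ∈ Icc (0 : ℝ) 1, ∀ p ∈ K,
    ContDiffWithinAt ℝ ∞ (fun q : ℝ × E => inChart (γ q.1) p q.2)
      (Icc (0 : ℝ) 1 ×ˢ univ) (τ, extChartAt I p p)
  symm : ∀ τ ∈ Icc (0 : ℝ) 1, ∀ p ∈ K, ∀ v w : TangentSpace I p, γ τ p v w = γ τ p w v
  pos : ∀ τ ∈ Icc (0 : ℝ) 1, ∀ p ∈ K, ∀ v : TangentSpace I p, v ≠ 0 → 0 < γ τ p v v
  psc : ∀ τ ∈ Icc (0 : ℝ) 1, ∀ p ∈ K, 0 < scalarCurvature (γ τ) p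

end Manifolds

/-! ### Doubly warped product metrics on `D^n × S^m` -/

/-- The unit sphere `S^m` in `ℝ^(m+1)`. -/
abbrev Sph (m : ℕ) : Type := sphere (0 : EuclideanSpace ℝ (Fin (m + 1))) 1

/-- The model with corners of the manifold `ℝ^n × S^m` (which has no boundary). -/
abbrev model (n m : ℕ) :=
  (𝓘(ℝ, EuclideanSpace ℝ (Fin n))).prod (𝓡 m)

/-- `D^n × S^m ⊆ ℝ^n × S^m`, where `D^n` is the closed disc of radius `a`. -/
def discTimesSphere (n m : ℕ) (a : ℝ) : Set (EuclideanSpace ℝ (Fin n) × Sph m) :=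
  {p | ‖p.1‖ ≤ a}

/-- The Euclidean metric of `ℝ^n`. -/
def euclid (n : ℕ) :
    EuclideanSpace ℝ (Fin n) →L[ℝ] EuclideanSpace ℝ (Fin n) →L[ℝ] ℝ :=
  innerSL ℝ

theorem euclid_apply {n : ℕ} (v w : EuclideanSpace ℝ (Fin n)) : euclid n v w = inner ℝ v w := rfl

/-- The differential `dr` of `r = ‖x‖` at `x ≠ 0`. -/
def dr {n : ℕ} (x : EuclideanSpace ℝ (Fin n)) : EuclideanSpace ℝ (Fin n) →L[ℝ] ℝ :=
  ‖x‖⁻¹ • euclid n x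

/-- The pull-back of the round metric `ds²_{n-1}` of the unit sphere under `x ↦ x / ‖x‖`, for
`x ≠ 0`, i.e. `(⟨v, w⟩ - dr(v) dr(w)) / ‖x‖²`. -/
def angular {n : ℕ} (x : EuclideanSpace ℝ (Fin n)) :
    EuclideanSpace ℝ (Fin n) →L[ℝ] EuclideanSpace ℝ (Fin n) →L[ℝ] ℝ :=
  (‖x‖ ^ 2)⁻¹ • (euclid n - (dr x).smulRight (dr x))

/-- The metric `dr² + h(r)² ds²_{n-1}` on a disc in `ℝ^n`. At the centre it is given the Euclidean
value, which is the limit whenever `h(0) = 0` and `h'(0) = 1`. -/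
def polarMetric {n : ℕ} (h : ℝ → ℝ) (x : EuclideanSpace ℝ (Fin n)) :
    EuclideanSpace ℝ (Fin n) →L[ℝ] EuclideanSpace ℝ (Fin n) →L[ℝ] ℝ :=
  open Classical in
  if x = 0 then euclid n else (dr x).smulRight (dr x) + h ‖x‖ ^ 2 • angular x

/-- The round metric `ds²_m` of `S^m`, induced from `ℝ^(m+1)`. -/
def roundMetric {m : ℕ} : TwoTensor (𝓡 m) (Sph m) := fun y =>
  let L : EuclideanSpace ℝ (Fin m) →L[ℝ] EuclideanSpace ℝ (Fin (m + 1)) :=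
    mfderiv (𝓡 m) 𝓘(ℝ, EuclideanSpace ℝ (Fin (m + 1)))
      (fun q : Sph m => (q : EuclideanSpace ℝ (Fin (m + 1)))) y
  (euclid (m + 1)).bilinearComp L L

/-- The doubly warped product metric `dr² + h(r)² ds²_{n-1} + ψ(r)² ds²_m`. -/
def doublyWarped (n m : ℕ) (h ψ : ℝ → ℝ) :
    TwoTensor (model n m) (EuclideanSpace ℝ (Fin n) × Sph m) := fun p =>
  let A : EuclideanSpace ℝ (Fin n) →L[ℝ] EuclideanSpace ℝ (Fin n) →L[ℝ] ℝ := polarMetric h p.1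
  let B : EuclideanSpace ℝ (Fin m) →L[ℝ] EuclideanSpace ℝ (Fin m) →L[ℝ] ℝ := roundMetric p.2
  let P₁ := ContinuousLinearMap.fst ℝ (EuclideanSpace ℝ (Fin n)) (EuclideanSpace ℝ (Fin m))
  let P₂ := ContinuousLinearMap.snd ℝ (EuclideanSpace ℝ (Fin n)) (EuclideanSpace ℝ (Fin m))
  A.bilinearComp P₁ P₁ + ψ ‖p.1‖ ^ 2 • B.bilinearComp P₂ P₂

/-- The metric `dr² + h(r)² ds²_{n-1} + k² (f(r) + α)² ds²_m`. -/
def surgeryMetric (n m : ℕ) (k α : ℝ) (f h : ℝ → ℝ) :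
    TwoTensor (model n m) (EuclideanSpace ℝ (Fin n) × Sph m) :=
  doublyWarped n m h (fun r => k * (f r + α))

end PSC

end

noncomputable section

namespace PSC

section CoordinateLemmas

variable {E : Type*} [NormedAddCommGroup E] [NormedSpace ℝ E]

theorem christoffelLower_congr {g g' : E → E →L[ℝ] E →L[ℝ] ℝ} {x : E}
    (h : g =ᶠ[nhds x] g') : christoffelLower g x = christoffelLower g' x := by
  simp only [christoffelLower, h.fderiv_eq]

theorem christoffel_congr {g g' : E → E →L[ℝ] E →L[ℝ] ℝ} {x : E}
    (h : g =ᶠ[nhds x] g') : christoffel g x = christoffel g' x := by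
  simp only [christoffel, christoffelLower_congr h, h.eq_of_nhds]

theorem curvature_congr {g g' : E → E →L[ℝ] E →L[ℝ] ℝ} {x : E}
    (h : g =ᶠ[nhds x] g') : curvature g x = curvature g' x := by
  have hc : christoffel g =ᶠ[nhds x] christoffel g' := by
    filter_upwards [h.eventuallyEq_nhds] with y hy using christoffel_congr hy
  funext v w
  simp only [curvature, hc.fderiv_eq, hc.eq_of_nhds]

theorem ricci_congr {g g' : E → E →L[ℝ] E →L[ℝ] ℝ} {x : E}
    (h : g =ᶠ[nhds x] g') : ricci g x = ricci g' x := by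
  simp only [ricci, curvature_congr h]

theorem christoffel_apply_eq {g : E → E →L[ℝ] E →L[ℝ] ℝ} {x v w Γ : E}
    (hg : (g x).IsInvertible) (hΓ : ∀ z, christoffelLower g x v w z = g x Γ z) :
    christoffel g x v w = Γ := by
  have : christoffelLower g x v w = g x Γ := ContinuousLinearMap.ext hΓ
  simp only [christoffel, ContinuousLinearMap.comp_apply, ContinuousLinearMap.compL_apply, this]
  exact hg.inverse_apply_self Γ

theorem contDiffAt_christoffelLower {g : E → E →L[ℝ] E →L[ℝ] ℝ} {x : E}
    (hg : ContDiffAt ℝ ∞ g x) : ContDiffAt ℝ ∞ (christoffelLower g) x := by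
  have h1 : ContDiffAt ℝ ∞ (fderiv ℝ g) x := hg.fderiv_right le_rfl
  have h2 : ContDiffAt ℝ ∞ (fun y => (fderiv ℝ g y).flip) x :=
    (ContinuousLinearMap.flipₗᵢ ℝ E E (E →L[ℝ] ℝ)).toContinuousLinearEquiv.contDiff.contDiffAt.comp
      x h1
  unfold christoffelLower
  exact ContDiffAt.const_smul (1 / 2 : ℝ) ((h1.add h2).sub (contDiffAt_const.clm_comp h2))

variable [FiniteDimensional ℝ E]

theorem coordScalarCurvature_congr {g g' : E → E →L[ℝ] E →L[ℝ] ℝ} {x : E}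
    (h : g =ᶠ[nhds x] g') : coordScalarCurvature g x = coordScalarCurvature g' x := by
  simp only [coordScalarCurvature, ricci_congr h, h.eq_of_nhds]

theorem isInvertible_of_pos {B : E →L[ℝ] E →L[ℝ] ℝ} (hB : ∀ v, v ≠ 0 → 0 < B v v) :
    B.IsInvertible := by
  have hinj : Function.Injective (B : E →ₗ[ℝ] E →L[ℝ] ℝ) := by
    rw [← LinearMap.ker_eq_bot, LinearMap.ker_eq_bot']
    intro v hv
    by_contra h
    have h1 := hB v h
    have h2 : B v = 0 := hv
    simp [h2] at h1
  have hdim : finrank ℝ E = finrank ℝ (E →L[ℝ] ℝ) := by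
    rw [← (LinearMap.toContinuousLinearMap : (E →ₗ[ℝ] ℝ) ≃ₗ[ℝ] (E →L[ℝ] ℝ)).finrank_eq]
    exact (Subspace.dual_finrank_eq (K := ℝ) (V := E)).symm
  refine ⟨(LinearEquiv.ofInjectiveOfFinrankEq (B : E →ₗ[ℝ] E →L[ℝ] ℝ) hinj
    hdim).toContinuousLinearEquiv, ?_⟩
  ext v w
  rfl

theorem contDiffAt_christoffel {g : E → E →L[ℝ] E →L[ℝ] ℝ} {x : E}
    (hg : ContDiffAt ℝ ∞ g x) (hinv : (g x).IsInvertible) :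
    ContDiffAt ℝ ∞ (christoffel g) x := by
  have : CompleteSpace E := FiniteDimensional.complete ℝ E
  have h1 : ContDiffAt ℝ ∞ (fun y => (g y).inverse) x :=
    hinv.contDiffAt_map_inverse.comp x hg
  unfold christoffel
  exact ((ContinuousLinearMap.compL ℝ E (E →L[ℝ] ℝ) E).contDiff.contDiffAt.comp x h1).clm_comp
    (contDiffAt_christoffelLower hg)

/-- The scalar curvature as a double sum over a basis which is orthogonal at the given point and
which diagonalises the curvature operators `u ↦ R(u, e) e`. -/
theorem coordScalarCurvature_eq_sum {ι : Type*} [Fintype ι] [DecidableEq ι]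
    (b : Basis ι ℝ E) {g : E → E →L[ℝ] E →L[ℝ] ℝ} {x : E} (hg : (g x).IsInvertible)
    (G : ι → ℝ) (hG : ∀ i, G i ≠ 0) (hb : ∀ i j, g x (b i) (b j) = if i = j then G i else 0)
    (κ : ι → ι → ℝ) (hκ : ∀ i j, curvature g x (b i) (b i) (b j) = (κ i j * G i) • b j) :
    coordScalarCurvature g x = ∑ i, ∑ j, κ i j := by
  have hrepr : ∀ (ℓ : E →L[ℝ] ℝ) i, b.repr ((g x).inverse ℓ) i = (G i)⁻¹ * ℓ (b i) := by
    intro ℓ i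
    have h1 : g x ((g x).inverse ℓ) (b i) = ℓ (b i) := by rw [hg.self_apply_inverse]
    have h2 : g x ((g x).inverse ℓ) (b i) = b.repr ((g x).inverse ℓ) i * G i := by
      conv_lhs => rw [← b.sum_repr ((g x).inverse ℓ)]
      simp only [map_sum, map_smul, sum_apply, smul_apply,
        hb, smul_eq_mul, mul_ite, mul_zero, Finset.sum_ite_eq', Finset.mem_univ, if_true]
    rw [← h1, h2]
    field_simp [hG i]
  have hric : ∀ i, ricci g x (b i) (b i) = ∑ j, κ i j * G i := by
    intro i
    change LinearMap.trace ℝ E (curvature g x (b i) (b i) : E →ₗ[ℝ] E) = _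
    rw [LinearMap.trace_eq_matrix_trace ℝ b, Matrix.trace]
    refine Finset.sum_congr rfl fun j _ => ?_
    simp [LinearMap.toMatrix_apply, hκ]
  rw [coordScalarCurvature, LinearMap.trace_eq_matrix_trace ℝ b, Matrix.trace]
  refine Finset.sum_congr rfl fun i _ => ?_
  rw [Matrix.diag_apply, LinearMap.toMatrix_apply]
  refine (hrepr _ i).trans ?_
  refine (congrArg ((G i)⁻¹ * ·) (hric i)).trans ?_
  simp only [Finset.mul_sum]
  refine Finset.sum_congr rfl fun j _ => ?_
  field_simp [hG i]

end CoordinateLemmas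

section WarpedModel

/-- The conformal factor of stereographic projection. -/
def conf {V : Type*} [NormedAddCommGroup V] (w : V) : ℝ := 4 / (‖w‖ ^ 2 + 4)

theorem conf_pos {V : Type*} [NormedAddCommGroup V] (w : V) : 0 < conf w := by
  unfold conf; positivity

@[simp]
theorem conf_zero {V : Type*} [NormedAddCommGroup V] : conf (0 : V) = 1 := by simp [conf]

variable {V₁ V₂ : Type*} [NormedAddCommGroup V₁] [InnerProductSpace ℝ V₁]
  [NormedAddCommGroup V₂] [InnerProductSpace ℝ V₂]

theorem hasDerivAt_conf_line (w q : V₂) :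
    HasDerivAt (fun t : ℝ => conf (w + t • q)) (-(conf w ^ 2 * inner ℝ w q / 2)) 0 := by
  have h0 : HasDerivAt (fun t : ℝ => w + t • q) q 0 := by
    simpa using ((hasDerivAt_id (0 : ℝ)).smul_const q).const_add w
  have h1 := h0.norm_sq.add_const 4
  have h2 := (hasDerivAt_const (0 : ℝ) (4 : ℝ)).div h1 (by positivity)
  refine h2.congr_deriv ?_
  simp only [zero_smul, add_zero, conf]
  have : ‖w‖ ^ 2 + 4 ≠ 0 := by positivity
  field_simp
  ring

theorem hasDerivAt_norm_line {x : V₁} (hx : x ≠ 0) (p : V₁) :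
    HasDerivAt (fun t : ℝ => ‖x + t • p‖) (inner ℝ x p / ‖x‖) 0 := by
  have h0 : HasDerivAt (fun t : ℝ => x + t • p) p 0 := by
    simpa using ((hasDerivAt_id (0 : ℝ)).smul_const p).const_add x
  have h1 := h0.norm_sq.sqrt (by simpa using hx)
  have hfun : (fun t : ℝ => √(‖x + t • p‖ ^ 2)) = fun t : ℝ => ‖x + t • p‖ := by
    funext t; exact Real.sqrt_sq (norm_nonneg _)
  rw [hfun] at h1
  refine h1.congr_deriv ?_
  simp only [zero_smul, add_zero, Real.sqrt_sq (norm_nonneg _)]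
  have : ‖x‖ ≠ 0 := norm_ne_zero_iff.2 hx
  field_simp

theorem hasDerivAt_comp_norm_line {x : V₁} (hx : x ≠ 0) (p : V₁) {u : ℝ → ℝ} {u' : ℝ}
    (hu : HasDerivAt u u' ‖x‖) :
    HasDerivAt (fun t : ℝ => u ‖x + t • p‖) (u' * (inner ℝ x p / ‖x‖)) 0 := by
  have h : HasDerivAt u u' ‖x + (0 : ℝ) • p‖ := by simpa using hu
  exact h.comp (0 : ℝ) (hasDerivAt_norm_line hx p)

theorem hasDerivAt_inner_line (x p a : V₁) :
    HasDerivAt (fun t : ℝ => inner ℝ (x + t • p) a) (inner ℝ p a) 0 := by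
  have h0 : HasDerivAt (fun t : ℝ => x + t • p) p 0 := by
    simpa using ((hasDerivAt_id (0 : ℝ)).smul_const p).const_add x
  simpa using h0.inner ℝ (hasDerivAt_const (0 : ℝ) a)

theorem hasDerivAt_line (x p : V₁) : HasDerivAt (fun t : ℝ => x + t • p) p 0 := by
  simpa using ((hasDerivAt_id (0 : ℝ)).smul_const p).const_add x

/-- The form `u |dx|² + v ⟨x, dx⟩² + B φ² |dw|²`. -/
def isoForm (u v B : ℝ) (z V W : V₁ × V₂) : ℝ :=
  u * inner ℝ V.1 W.1 + v * (inner ℝ z.1 V.1 * inner ℝ z.1 W.1)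
    + B * conf z.2 ^ 2 * inner ℝ V.2 W.2

/-- The derivative in the direction `U` of `isoForm (u r) (v r) (B r)`, `r = ‖x‖`. -/
def isoFormDeriv (v B u' v' B' : ℝ) (z U V W : V₁ × V₂) : ℝ :=
  u' * (inner ℝ z.1 U.1 / ‖z.1‖) * inner ℝ V.1 W.1
    + (v' * (inner ℝ z.1 U.1 / ‖z.1‖) * (inner ℝ z.1 V.1 * inner ℝ z.1 W.1)
      + v * (inner ℝ U.1 V.1 * inner ℝ z.1 W.1 + inner ℝ z.1 V.1 * inner ℝ U.1 W.1))
    + (B' * (inner ℝ z.1 U.1 / ‖z.1‖) * conf z.2 ^ 2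
      - B * (conf z.2 ^ 3 * inner ℝ z.2 U.2)) * inner ℝ V.2 W.2

theorem hasDerivAt_isoForm {u v B : ℝ → ℝ} {u' v' B' : ℝ} {z : V₁ × V₂} (hz : z.1 ≠ 0)
    (hu : HasDerivAt u u' ‖z.1‖) (hv : HasDerivAt v v' ‖z.1‖) (hB : HasDerivAt B B' ‖z.1‖)
    (U V W : V₁ × V₂) :
    HasDerivAt (fun t : ℝ => isoForm (u ‖(z + t • U).1‖) (v ‖(z + t • U).1‖)
        (B ‖(z + t • U).1‖) (z + t • U) V W)
      (isoFormDeriv (v ‖z.1‖) (B ‖z.1‖) u' v' B' z U V W) 0 := by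
  have h1 := (hasDerivAt_comp_norm_line hz U.1 hu).mul_const (inner ℝ V.1 W.1)
  have h2 := (hasDerivAt_comp_norm_line hz U.1 hv).mul
    ((hasDerivAt_inner_line z.1 U.1 V.1).mul (hasDerivAt_inner_line z.1 U.1 W.1))
  have h3 := ((hasDerivAt_comp_norm_line hz U.1 hB).mul
    ((hasDerivAt_conf_line z.2 U.2).pow 2)).mul_const (inner ℝ V.2 W.2)
  refine ((h1.add h2).add h3).congr_deriv ?_
  simp only [isoFormDeriv, zero_smul, add_zero, Pi.mul_apply, Pi.pow_apply]
  ring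

/-- The Christoffel symbols of an isotropic form, in terms of five coefficients. -/
def isoGamma (A₁ A₂ A₃ A₄ A₅ : ℝ) (z V W : V₁ × V₂) : V₁ × V₂ :=
  (A₁ • (inner ℝ z.1 V.1 • W.1 + inner ℝ z.1 W.1 • V.1)
    + (A₂ * inner ℝ V.1 W.1 + A₃ * (inner ℝ z.1 V.1 * inner ℝ z.1 W.1)
      + A₄ * (conf z.2 ^ 2 * inner ℝ V.2 W.2)) • z.1,
   A₅ • (inner ℝ z.1 V.1 • W.2 + inner ℝ z.1 W.1 • V.2)
    - (conf z.2 / 2) • (inner ℝ z.2 V.2 • W.2 + inner ℝ z.2 W.2 • V.2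
      - inner ℝ V.2 W.2 • z.2))

theorem isoGamma_koszul {u v B u' v' B' A₁ A₂ A₃ A₄ A₅ : ℝ} {z : V₁ × V₂} (hz : z.1 ≠ 0)
    (h₁ : u * A₁ = u' / (2 * ‖z.1‖))
    (h₂ : (u + v * ‖z.1‖ ^ 2) * A₂ = v - u' / (2 * ‖z.1‖))
    (h₃ : (u + v * ‖z.1‖ ^ 2) * A₃ + 2 * (v * A₁) = v' / (2 * ‖z.1‖))
    (h₄ : (u + v * ‖z.1‖ ^ 2) * A₄ = - (B' / (2 * ‖z.1‖)))
    (h₅ : B * A₅ = B' / (2 * ‖z.1‖)) (V W Z : V₁ × V₂) :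
    1 / 2 * (isoFormDeriv v B u' v' B' z V W Z + isoFormDeriv v B u' v' B' z W V Z
      - isoFormDeriv v B u' v' B' z Z V W)
      = isoForm u v B z (isoGamma A₁ A₂ A₃ A₄ A₅ z V W) Z := by
  have hr : ‖z.1‖ ≠ 0 := norm_ne_zero_iff.2 hz
  simp only [isoFormDeriv, isoForm, isoGamma, inner_add_left, inner_add_right, inner_sub_left,
    real_inner_smul_left, real_inner_smul_right, real_inner_self_eq_norm_sq]
  rw [real_inner_comm W.1 V.1, real_inner_comm Z.1 V.1, real_inner_comm Z.1 W.1,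
    real_inner_comm W.2 V.2, real_inner_comm Z.2 V.2, real_inner_comm Z.2 W.2]
  generalize ‖z.1‖ = r at *
  have e₁ : u' / r = 2 * (u * A₁) := by rw [h₁]; field_simp
  have e₃ : v' / r = 2 * ((u + v * r ^ 2) * A₃ + 2 * (v * A₁)) := by rw [h₃]; field_simp
  have e₅ : B' / r = 2 * (B * A₅) := by rw [h₅]; field_simp
  have e₄ : (u + v * r ^ 2) * A₄ = - (B * A₅) := by rw [h₄, h₅]
  have e₂ : (u + v * r ^ 2) * A₂ = v - u * A₁ := by rw [h₂, h₁]
  have f₁ : ∀ s, u' * (s / r) = 2 * (u * A₁) * s := fun s => by rw [← e₁]; ring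
  have f₃ : ∀ s, v' * (s / r) = 2 * ((u + v * r ^ 2) * A₃ + 2 * (v * A₁)) * s :=
    fun s => by rw [← e₃]; ring
  have f₅ : ∀ s, B' * (s / r) = 2 * (B * A₅) * s := fun s => by rw [← e₅]; ring
  simp only [f₁, f₃, f₅]
  linear_combination (-inner ℝ W.1 V.1 * inner ℝ z.1 Z.1) * e₂
    - (conf z.2 ^ 2 * inner ℝ W.2 V.2 * inner ℝ z.1 Z.1) * e₄

/-- The derivative of `isoGamma (A₁ r) ...` in the direction `U` at `(x, 0)`. -/
def isoGammaDeriv (A₁ A₂ A₃ A₄ A₅ A₁' A₂' A₃' A₄' A₅' : ℝ) (x : V₁) (U V W : V₁ × V₂) : V₁ × V₂ :=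
  ((A₁' * (inner ℝ x U.1 / ‖x‖)) • (inner ℝ x V.1 • W.1 + inner ℝ x W.1 • V.1)
    + A₁ • (inner ℝ U.1 V.1 • W.1 + inner ℝ U.1 W.1 • V.1)
    + (A₂' * (inner ℝ x U.1 / ‖x‖) * inner ℝ V.1 W.1
      + (A₃' * (inner ℝ x U.1 / ‖x‖) * (inner ℝ x V.1 * inner ℝ x W.1)
        + A₃ * (inner ℝ U.1 V.1 * inner ℝ x W.1 + inner ℝ x V.1 * inner ℝ U.1 W.1))
      + A₄' * (inner ℝ x U.1 / ‖x‖) * inner ℝ V.2 W.2) • x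
    + (A₂ * inner ℝ V.1 W.1 + A₃ * (inner ℝ x V.1 * inner ℝ x W.1)
      + A₄ * inner ℝ V.2 W.2) • U.1,
   (A₅' * (inner ℝ x U.1 / ‖x‖)) • (inner ℝ x V.1 • W.2 + inner ℝ x W.1 • V.2)
    + A₅ • (inner ℝ U.1 V.1 • W.2 + inner ℝ U.1 W.1 • V.2)
    - (1 / 2 : ℝ) • (inner ℝ U.2 V.2 • W.2 + inner ℝ U.2 W.2 • V.2
      - inner ℝ V.2 W.2 • U.2))

theorem hasDerivAt_isoGamma {A₁ A₂ A₃ A₄ A₅ : ℝ → ℝ} {A₁' A₂' A₃' A₄' A₅' : ℝ} {x : V₁}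
    (hx : x ≠ 0) (h₁ : HasDerivAt A₁ A₁' ‖x‖) (h₂ : HasDerivAt A₂ A₂' ‖x‖)
    (h₃ : HasDerivAt A₃ A₃' ‖x‖) (h₄ : HasDerivAt A₄ A₄' ‖x‖) (h₅ : HasDerivAt A₅ A₅' ‖x‖)
    (U V W : V₁ × V₂) :
    HasDerivAt (fun t : ℝ => isoGamma (A₁ ‖((x, (0 : V₂)) + t • U).1‖)
        (A₂ ‖((x, (0 : V₂)) + t • U).1‖) (A₃ ‖((x, (0 : V₂)) + t • U).1‖)
        (A₄ ‖((x, (0 : V₂)) + t • U).1‖) (A₅ ‖((x, (0 : V₂)) + t • U).1‖)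
        ((x, (0 : V₂)) + t • U) V W)
      (isoGammaDeriv (A₁ ‖x‖) (A₂ ‖x‖) (A₃ ‖x‖) (A₄ ‖x‖) (A₅ ‖x‖) A₁' A₂' A₃' A₄' A₅' x U V W)
      0 := by
  have k₁ := hasDerivAt_comp_norm_line hx U.1 h₁
  have k₂ := hasDerivAt_comp_norm_line hx U.1 h₂
  have k₃ := hasDerivAt_comp_norm_line hx U.1 h₃
  have k₄ := hasDerivAt_comp_norm_line hx U.1 h₄
  have k₅ := hasDerivAt_comp_norm_line hx U.1 h₅
  have iV := hasDerivAt_inner_line x U.1 V.1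
  have iW := hasDerivAt_inner_line x U.1 W.1
  have jV := hasDerivAt_inner_line 0 U.2 V.2
  have jW := hasDerivAt_inner_line 0 U.2 W.2
  have c := hasDerivAt_conf_line 0 U.2
  have lin := (iV.smul_const W.1).add (iW.smul_const V.1)
  have lin₂ := (iV.smul_const W.2).add (iW.smul_const V.2)
  have lin₃ := ((jV.smul_const W.2).add (jW.smul_const V.2)).sub
    ((hasDerivAt_line 0 U.2).const_smul (inner ℝ V.2 W.2))
  have p₁ := (k₁.smul lin).add ((((k₂.mul_const (inner ℝ V.1 W.1)).add (k₃.mul (iV.mul iW))).add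
    (k₄.mul ((c.pow 2).mul_const (inner ℝ V.2 W.2)))).smul (hasDerivAt_line x U.1))
  have p₂ := (k₅.smul lin₂).sub ((c.div_const 2).smul lin₃)
  refine (p₁.prodMk p₂).congr_deriv ?_
  simp only [isoGammaDeriv, zero_smul, add_zero, Pi.mul_apply, Pi.pow_apply, Pi.add_apply,
    Pi.sub_apply, conf_zero, inner_zero_left]
  ext1
  · simp only []
    module
  · simp only []
    module

end WarpedModel

section WarpedCurvature

variable {V₁ V₂ : Type*} [NormedAddCommGroup V₁] [InnerProductSpace ℝ V₁]
  [NormedAddCommGroup V₂] [InnerProductSpace ℝ V₂]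

/-- `R(U, V) V` at `(x, 0)` for Christoffel symbols of the form `isoGamma (A₁ r) ...`. -/
def isoCurv (A₁ A₂ A₃ A₄ A₅ A₁' A₂' A₃' A₄' A₅' : ℝ) (x : V₁) (U V : V₁ × V₂) : V₁ × V₂ :=
  isoGammaDeriv A₁ A₂ A₃ A₄ A₅ A₁' A₂' A₃' A₄' A₅' x U V V
    - isoGammaDeriv A₁ A₂ A₃ A₄ A₅ A₁' A₂' A₃' A₄' A₅' x V U V
    + isoGamma A₁ A₂ A₃ A₄ A₅ (x, 0) U (isoGamma A₁ A₂ A₃ A₄ A₅ (x, 0) V V)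
    - isoGamma A₁ A₂ A₃ A₄ A₅ (x, 0) V (isoGamma A₁ A₂ A₃ A₄ A₅ (x, 0) U V)

section Cases

variable (A₁ A₂ A₃ A₄ A₅ A₁' A₂' A₃' A₄' A₅' : ℝ) {r : ℝ} {e t t' : V₁} {s s' : V₂}

theorem isoCurv_self (x : V₁) (U : V₁ × V₂) :
    isoCurv A₁ A₂ A₃ A₄ A₅ A₁' A₂' A₃' A₄' A₅' x U U = 0 := by
  simp [isoCurv]

theorem isoCurv_tangential_radial (hr : 0 < r) (he : ‖e‖ = 1)
    (ht : inner ℝ e t = 0) :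
    isoCurv A₁ A₂ A₃ A₄ A₅ A₁' A₂' A₃' A₄' A₅' (r • e) (t, (0 : V₂)) (e, 0)
      = (A₂ + A₃ * r ^ 2 - A₁' * r - A₁ + (2 * A₁ * r + A₂ * r + A₃ * r ^ 3) * A₁ * r
          - A₁ ^ 2 * r ^ 2) • (t, (0 : V₂)) := by
  have ht' : inner ℝ t e = 0 := by rw [real_inner_comm, ht]
  have hn : ‖r • e‖ = r := by rw [norm_smul, he, mul_one, Real.norm_of_nonneg hr.le]
  have hr' := hr.ne'
  simp only [isoCurv, isoGammaDeriv, isoGamma, hn, real_inner_smul_left, real_inner_smul_right,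
    inner_add_right, inner_sub_right, real_inner_self_eq_norm_sq,
    inner_zero_right, inner_zero_left, conf_zero, he, ht, ht']
  ext1
  · simp only [Prod.fst_sub, Prod.fst_add, Prod.smul_fst]
    match_scalars <;> field_simp <;> ring
  · simp only [Prod.snd_sub, Prod.snd_add, Prod.smul_snd]
    match_scalars

theorem isoCurv_radial_tangential (hr : 0 < r) (he : ‖e‖ = 1)
    (ht : inner ℝ e t = 0) (hu : ‖t‖ = 1) :
    isoCurv A₁ A₂ A₃ A₄ A₅ A₁' A₂' A₃' A₄' A₅' (r • e) (e, (0 : V₂)) (t, 0)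
      = (A₂' * r + A₂ - A₁ - A₃ * r ^ 2 + A₂ * r * (2 * A₁ * r + A₂ * r + A₃ * r ^ 3)
          - A₁ * A₂ * r ^ 2) • (e, (0 : V₂)) := by
  have ht' : inner ℝ t e = 0 := by rw [real_inner_comm, ht]
  have hn : ‖r • e‖ = r := by rw [norm_smul, he, mul_one, Real.norm_of_nonneg hr.le]
  have hr' := hr.ne'
  simp only [isoCurv, isoGammaDeriv, isoGamma, hn, real_inner_smul_left, real_inner_smul_right,
    inner_add_right, inner_sub_right, real_inner_self_eq_norm_sq,
    inner_zero_right, inner_zero_left, conf_zero, he, ht, hu, ht']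
  ext1
  · simp only [Prod.fst_sub, Prod.fst_add, Prod.smul_fst]
    match_scalars <;> field_simp <;> ring
  · simp only [Prod.snd_sub, Prod.snd_add, Prod.smul_snd]
    match_scalars

theorem isoCurv_tangential_tangential (hr : 0 < r) (he : ‖e‖ = 1)
    (ht : inner ℝ e t = 0) (hu : ‖t‖ = 1)
    (ht₂ : inner ℝ e t' = 0) (htt : inner ℝ t t' = 0) :
    isoCurv A₁ A₂ A₃ A₄ A₅ A₁' A₂' A₃' A₄' A₅' (r • e) (t', (0 : V₂)) (t, 0)
      = (A₂ - A₁ + A₁ * A₂ * r ^ 2) • (t', (0 : V₂)) := by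
  have ht' : inner ℝ t e = 0 := by rw [real_inner_comm, ht]
  have ht₂' : inner ℝ t' e = 0 := by rw [real_inner_comm, ht₂]
  have htt' : inner ℝ t' t = 0 := by rw [real_inner_comm, htt]
  have hn : ‖r • e‖ = r := by rw [norm_smul, he, mul_one, Real.norm_of_nonneg hr.le]
  have hr' := hr.ne'
  simp only [isoCurv, isoGammaDeriv, isoGamma, hn, real_inner_smul_left, real_inner_smul_right,
    inner_add_right, inner_sub_right, real_inner_self_eq_norm_sq,
    inner_zero_right, inner_zero_left, conf_zero, ht, hu, ht₂, htt, ht', ht₂', htt']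
  ext1
  · simp only [Prod.fst_sub, Prod.fst_add, Prod.smul_fst]
    match_scalars <;> field_simp <;> ring
  · simp only [Prod.snd_sub, Prod.snd_add, Prod.smul_snd]
    match_scalars

theorem isoCurv_sphere_radial (hr : 0 < r) (he : ‖e‖ = 1) :
    isoCurv A₁ A₂ A₃ A₄ A₅ A₁' A₂' A₃' A₄' A₅' (r • e) ((0 : V₁), s) (e, 0)
      = (-(A₅' * r) - A₅ + A₅ * r * (2 * A₁ * r + A₂ * r + A₃ * r ^ 3) - A₅ ^ 2 * r ^ 2)
          • ((0 : V₁), s) := by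
  have hn : ‖r • e‖ = r := by rw [norm_smul, he, mul_one, Real.norm_of_nonneg hr.le]
  have hr' := hr.ne'
  simp only [isoCurv, isoGammaDeriv, isoGamma, hn, real_inner_smul_left, real_inner_smul_right,
    inner_add_right, inner_sub_right, real_inner_self_eq_norm_sq,
    inner_zero_right, inner_zero_left, conf_zero, he]
  ext1
  · simp only [Prod.fst_sub, Prod.fst_add, Prod.smul_fst]
    match_scalars
    field_simp
    ring
  · simp only [Prod.snd_sub, Prod.snd_add, Prod.smul_snd]
    match_scalars
    field_simp
    ring

theorem isoCurv_radial_sphere (hr : 0 < r) (he : ‖e‖ = 1) (hs : ‖s‖ = 1) :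
    isoCurv A₁ A₂ A₃ A₄ A₅ A₁' A₂' A₃' A₄' A₅' (r • e) (e, (0 : V₂)) (0, s)
      = (A₄' * r + A₄ + A₄ * r * (2 * A₁ * r + A₂ * r + A₃ * r ^ 3) - A₄ * A₅ * r ^ 2)
          • (e, (0 : V₂)) := by
  have hn : ‖r • e‖ = r := by rw [norm_smul, he, mul_one, Real.norm_of_nonneg hr.le]
  have hr' := hr.ne'
  simp only [isoCurv, isoGammaDeriv, isoGamma, hn, real_inner_smul_left, real_inner_smul_right,
    inner_add_right, inner_sub_right, real_inner_self_eq_norm_sq,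
    inner_zero_right, inner_zero_left, conf_zero, he, hs]
  ext1
  · simp only [Prod.fst_sub, Prod.fst_add, Prod.smul_fst]
    match_scalars
    field_simp
    ring
  · simp only [Prod.snd_sub, Prod.snd_add, Prod.smul_snd]
    match_scalars
    field_simp
    ring

theorem isoCurv_sphere_tangential (hr : 0 < r) (he : ‖e‖ = 1)
    (ht : inner ℝ e t = 0) (hu : ‖t‖ = 1) :
    isoCurv A₁ A₂ A₃ A₄ A₅ A₁' A₂' A₃' A₄' A₅' (r • e) ((0 : V₁), s) (t, 0)
      = (-A₅ + A₂ * A₅ * r ^ 2) • ((0 : V₁), s) := by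
  have ht' : inner ℝ t e = 0 := by rw [real_inner_comm, ht]
  have hn : ‖r • e‖ = r := by rw [norm_smul, he, mul_one, Real.norm_of_nonneg hr.le]
  have hr' := hr.ne'
  simp only [isoCurv, isoGammaDeriv, isoGamma, hn, real_inner_smul_left, real_inner_smul_right,
    inner_add_right, inner_sub_right, real_inner_self_eq_norm_sq,
    inner_zero_right, inner_zero_left, conf_zero, ht, hu, ht']
  ext1
  · simp only [Prod.fst_sub, Prod.fst_add, Prod.smul_fst]
    match_scalars <;> field_simp <;> ring
  · simp only [Prod.snd_sub, Prod.snd_add, Prod.smul_snd]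
    match_scalars
    field_simp
    ring

theorem isoCurv_tangential_sphere (hr : 0 < r) (he : ‖e‖ = 1)
    (ht : inner ℝ e t = 0) (hs : ‖s‖ = 1) :
    isoCurv A₁ A₂ A₃ A₄ A₅ A₁' A₂' A₃' A₄' A₅' (r • e) (t, (0 : V₂)) (0, s)
      = (A₄ + A₁ * A₄ * r ^ 2) • (t, (0 : V₂)) := by
  have ht' : inner ℝ t e = 0 := by rw [real_inner_comm, ht]
  have hn : ‖r • e‖ = r := by rw [norm_smul, he, mul_one, Real.norm_of_nonneg hr.le]
  have hr' := hr.ne'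
  simp only [isoCurv, isoGammaDeriv, isoGamma, hn, real_inner_smul_left, real_inner_smul_right,
    inner_add_right, inner_sub_right, real_inner_self_eq_norm_sq,
    inner_zero_right, inner_zero_left, conf_zero, ht, hs, ht']
  ext1
  · simp only [Prod.fst_sub, Prod.fst_add, Prod.smul_fst]
    match_scalars <;> field_simp <;> ring
  · simp only [Prod.snd_sub, Prod.snd_add, Prod.smul_snd]
    match_scalars
    field_simp
    ring

theorem isoCurv_sphere_sphere (hr : 0 < r) (he : ‖e‖ = 1) (hs : ‖s‖ = 1) (hss : inner ℝ s s' = 0) :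
    isoCurv A₁ A₂ A₃ A₄ A₅ A₁' A₂' A₃' A₄' A₅' (r • e) ((0 : V₁), s') (0, s)
      = (1 + A₄ * A₅ * r ^ 2) • ((0 : V₁), s') := by
  have hss' : inner ℝ s' s = 0 := by rw [real_inner_comm, hss]
  have hn : ‖r • e‖ = r := by rw [norm_smul, he, mul_one, Real.norm_of_nonneg hr.le]
  have hr' := hr.ne'
  simp only [isoCurv, isoGammaDeriv, isoGamma, hn, real_inner_smul_right,
    inner_add_right, inner_sub_right, real_inner_self_eq_norm_sq,
    inner_zero_right, inner_zero_left, conf_zero, hs, hss, hss']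
  ext1
  · simp only [Prod.fst_sub, Prod.fst_add, Prod.smul_fst]
    match_scalars
    field_simp
    ring
  · simp only [Prod.snd_sub, Prod.snd_add, Prod.smul_snd]
    match_scalars <;> field_simp <;> ring

end Cases

end WarpedCurvature

/-- The scalar curvature of `dr² + h² ds²_{n-1} + ψ² ds²_m` away from the centre. -/
def warpedScal (n m : ℝ) (h ψ : ℝ → ℝ) (r : ℝ) : ℝ :=
  2 * (n - 1) * (-deriv (deriv h) r / h r)
    + (n - 1) * (n - 2) * ((1 - deriv h r ^ 2) / h r ^ 2)
    + 2 * m * (-deriv (deriv ψ) r / ψ r)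
    + 2 * m * (n - 1) * (-(deriv h r * deriv ψ r) / (h r * ψ r))
    + m * (m - 1) * ((1 - deriv ψ r ^ 2) / ψ r ^ 2)

section WarpedScalar

variable {V₁ V₂ : Type*} [NormedAddCommGroup V₁] [InnerProductSpace ℝ V₁]
  [NormedAddCommGroup V₂] [InnerProductSpace ℝ V₂]

/-- The metric `dr² + h² ds²_{n-1} + ψ² ds²_m` in Cartesian and stereographic coordinates. -/
def warpedForm (h ψ : ℝ → ℝ) (z V W : V₁ × V₂) : ℝ :=
  isoForm (h ‖z.1‖ ^ 2 / ‖z.1‖ ^ 2) ((1 - h ‖z.1‖ ^ 2 / ‖z.1‖ ^ 2) / ‖z.1‖ ^ 2) (ψ ‖z.1‖ ^ 2) z V W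

theorem warpedForm_pos {h ψ : ℝ → ℝ} {z V : V₁ × V₂} (hz : z.1 ≠ 0) (hh : h ‖z.1‖ ≠ 0)
    (hψ : ψ ‖z.1‖ ≠ 0) (hV : V ≠ 0) : 0 < warpedForm h ψ z V V := by
  have hr : 0 < ‖z.1‖ := norm_pos_iff.2 hz
  have hcs : inner ℝ z.1 V.1 ^ 2 ≤ ‖z.1‖ ^ 2 * ‖V.1‖ ^ 2 := by
    rw [← mul_pow]
    exact sq_le_sq' (neg_le_of_abs_le (abs_real_inner_le_norm _ _)) (real_inner_le_norm _ _)
  have hc := conf_pos z.2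
  simp only [warpedForm, isoForm, real_inner_self_eq_norm_sq]
  generalize inner ℝ z.1 V.1 = s at *
  have key : h ‖z.1‖ ^ 2 / ‖z.1‖ ^ 2 * ‖V.1‖ ^ 2
      + (1 - h ‖z.1‖ ^ 2 / ‖z.1‖ ^ 2) / ‖z.1‖ ^ 2 * (s * s)
      = h ‖z.1‖ ^ 2 * ((‖z.1‖ ^ 2 * ‖V.1‖ ^ 2 - s ^ 2) / ‖z.1‖ ^ 4) + s ^ 2 / ‖z.1‖ ^ 2 := by
    field_simp; ring
  rw [key]
  have h1 : 0 < h ‖z.1‖ ^ 2 := by positivity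
  have h2 : 0 < ψ ‖z.1‖ ^ 2 := by positivity
  have t1 : 0 ≤ (‖z.1‖ ^ 2 * ‖V.1‖ ^ 2 - s ^ 2) / ‖z.1‖ ^ 4 :=
    div_nonneg (sub_nonneg.2 hcs) (by positivity)
  have t1' := mul_nonneg h1.le t1
  have t2 : 0 ≤ s ^ 2 / ‖z.1‖ ^ 2 := by positivity
  have t3 : 0 ≤ ψ ‖z.1‖ ^ 2 * conf z.2 ^ 2 * ‖V.2‖ ^ 2 := by positivity
  by_cases hV2 : V.2 = 0
  · have hV1 : 0 < ‖V.1‖ := norm_pos_iff.2 fun h => hV (Prod.ext h hV2)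
    by_cases hs : s = 0
    · have : 0 < h ‖z.1‖ ^ 2 * ((‖z.1‖ ^ 2 * ‖V.1‖ ^ 2 - s ^ 2) / ‖z.1‖ ^ 4) := by
        rw [hs]
        have : 0 < ‖z.1‖ ^ 2 * ‖V.1‖ ^ 2 - 0 ^ 2 := by
          have : 0 < ‖z.1‖ ^ 2 * ‖V.1‖ ^ 2 := by positivity
          simpa using this
        positivity
      linarith
    · have : 0 < s ^ 2 / ‖z.1‖ ^ 2 := by positivity
      linarith
  · have hV2' : 0 < ‖V.2‖ := norm_pos_iff.2 hV2
    have : 0 < ψ ‖z.1‖ ^ 2 * conf z.2 ^ 2 * ‖V.2‖ ^ 2 := by positivity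
    linarith

theorem hasDerivAt_clm_line {E F : Type*} [NormedAddCommGroup E] [NormedSpace ℝ E]
    [NormedAddCommGroup F] [NormedSpace ℝ F] {f : E → E →L[ℝ] E →L[ℝ] F} {z : E}
    (hf : DifferentiableAt ℝ f z) (U V W : E) :
    HasDerivAt (fun t : ℝ => f (z + t • U) V W) (fderiv ℝ f z U V W) 0 := by
  have hl : HasDerivAt (fun t : ℝ => z + t • U) U 0 := by
    simpa using ((hasDerivAt_id (0 : ℝ)).smul_const U).const_add z
  have hf' : HasFDerivAt f (fderiv ℝ f z) (z + (0 : ℝ) • U) := by simpa using hf.hasFDerivAt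
  have h1 := hf'.comp_hasDerivAt (0 : ℝ) hl
  have h2 := (h1.clm_apply (hasDerivAt_const (0 : ℝ) V)).clm_apply (hasDerivAt_const (0 : ℝ) W)
  simpa using h2

theorem eventually_line {E : Type*} [NormedAddCommGroup E] [NormedSpace ℝ E] {p : E → Prop} {z : E}
    (h : ∀ᶠ y in nhds z, p y) (U : E) : ∀ᶠ t : ℝ in nhds 0, p (z + t • U) := by
  have : Filter.Tendsto (fun t : ℝ => z + t • U) (nhds 0) (nhds z) := by
    have hc : Continuous (fun t : ℝ => z + t • U) := by fun_prop
    simpa using hc.tendsto 0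
  exact this.eventually h

/-- The coefficients of the Christoffel symbols of `warpedForm h ψ`. -/
def wA₁ (h : ℝ → ℝ) (r : ℝ) : ℝ := (r * deriv h r - h r) / (r ^ 2 * h r)
/-- See `wA₁`. -/
def wA₂ (h : ℝ → ℝ) (r : ℝ) : ℝ := (r - h r * deriv h r) / r ^ 3
/-- See `wA₁`. -/
def wA₃ (h : ℝ → ℝ) (r : ℝ) : ℝ := -(wA₂ h r + 2 * wA₁ h r) / r ^ 2
/-- See `wA₁`. -/
def wA₄ (ψ : ℝ → ℝ) (r : ℝ) : ℝ := -(ψ r * deriv ψ r) / r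
/-- See `wA₁`. -/
def wA₅ (ψ : ℝ → ℝ) (r : ℝ) : ℝ := deriv ψ r / (ψ r * r)

/-- The Christoffel symbols of `warpedForm h ψ`. -/
def warpedGamma (h ψ : ℝ → ℝ) (z V W : V₁ × V₂) : V₁ × V₂ :=
  isoGamma (wA₁ h ‖z.1‖) (wA₂ h ‖z.1‖) (wA₃ h ‖z.1‖) (wA₄ ψ ‖z.1‖) (wA₅ ψ ‖z.1‖) z V W

variable [FiniteDimensional ℝ V₁] [FiniteDimensional ℝ V₂]

theorem christoffel_warped {h ψ : ℝ → ℝ} {g : V₁ × V₂ → V₁ × V₂ →L[ℝ] V₁ × V₂ →L[ℝ] ℝ}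
    {z : V₁ × V₂} (hz : z.1 ≠ 0) (hd : DifferentiableAt ℝ h ‖z.1‖)
    (hψd : DifferentiableAt ℝ ψ ‖z.1‖) (hh : h ‖z.1‖ ≠ 0) (hψ : ψ ‖z.1‖ ≠ 0)
    (hgd : DifferentiableAt ℝ g z) (hg : ∀ᶠ y in nhds z, ∀ V W, g y V W = warpedForm h ψ y V W)
    (V W : V₁ × V₂) : christoffel g z V W = warpedGamma h ψ z V W := by
  have hr : ‖z.1‖ ≠ 0 := norm_ne_zero_iff.2 hz
  have hgz := hg.self_of_nhds
  have hinv : (g z).IsInvertible := isInvertible_of_pos fun v hv => by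
    rw [hgz]; exact warpedForm_pos hz hh hψ hv
  have hu := (hd.hasDerivAt.pow 2).div (hasDerivAt_pow 2 ‖z.1‖) (pow_ne_zero 2 hr)
  have hv := ((hasDerivAt_const ‖z.1‖ (1 : ℝ)).sub hu).div (hasDerivAt_pow 2 ‖z.1‖)
    (pow_ne_zero 2 hr)
  have hB := hψd.hasDerivAt.pow 2
  have hder : ∀ U V W, fderiv ℝ g z U V W = _ := fun U V W => by
    have h1 := hasDerivAt_clm_line hgd U V W
    have h2 := hasDerivAt_isoForm hz hu hv hB U V W
    refine h1.unique (h2.congr_of_eventuallyEq ?_)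
    filter_upwards [eventually_line hg U] with t ht
    rw [ht]
    rfl
  refine christoffel_apply_eq hinv fun Z => ?_
  rw [christoffelLower_apply, hder, hder, hder, hgz]
  simp only [Pi.pow_apply, Pi.div_apply, Pi.sub_apply]
  refine isoGamma_koszul hz ?_ ?_ ?_ ?_ ?_ V W Z
  all_goals
    simp only [wA₁, wA₂, wA₃, wA₄, wA₅]
    generalize ‖z.1‖ = r at *
    field_simp
    try ring

end WarpedScalar

section WarpedScalar

/-- The derivatives of `wA₁`, ..., `wA₅`. -/
def wA₁' (h : ℝ → ℝ) (r : ℝ) : ℝ :=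
  (r * deriv (deriv h) r * (r ^ 2 * h r)
    - (r * deriv h r - h r) * (2 * r * h r + r ^ 2 * deriv h r)) / (r ^ 2 * h r) ^ 2
/-- See `wA₁'`. -/
def wA₂' (h : ℝ → ℝ) (r : ℝ) : ℝ :=
  ((1 - deriv h r ^ 2 - h r * deriv (deriv h) r) * r ^ 3 - (r - h r * deriv h r) * (3 * r ^ 2))
    / (r ^ 3) ^ 2
/-- See `wA₁'`. -/
def wA₃' (h : ℝ → ℝ) (r : ℝ) : ℝ :=
  (-(wA₂' h r + 2 * wA₁' h r) * r ^ 2 + (wA₂ h r + 2 * wA₁ h r) * (2 * r)) / (r ^ 2) ^ 2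
/-- See `wA₁'`. -/
def wA₄' (ψ : ℝ → ℝ) (r : ℝ) : ℝ :=
  (-(deriv ψ r ^ 2 + ψ r * deriv (deriv ψ) r) * r + ψ r * deriv ψ r) / r ^ 2
/-- See `wA₁'`. -/
def wA₅' (ψ : ℝ → ℝ) (r : ℝ) : ℝ :=
  (deriv (deriv ψ) r * (ψ r * r) - deriv ψ r * (deriv ψ r * r + ψ r)) / (ψ r * r) ^ 2

theorem hasDerivAt_wA₁ {h : ℝ → ℝ} {r : ℝ} (hr : r ≠ 0) (hh : h r ≠ 0)
    (h0 : HasDerivAt h (deriv h r) r) (h1 : HasDerivAt (deriv h) (deriv (deriv h) r) r) :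
    HasDerivAt (wA₁ h) (wA₁' h r) r := by
  have := ((((hasDerivAt_id r).mul h1).sub h0).div ((hasDerivAt_pow 2 r).mul h0)
    (mul_ne_zero (pow_ne_zero 2 hr) hh))
  refine this.congr_deriv ?_
  simp only [wA₁', id, Pi.mul_apply, Pi.sub_apply]
  field_simp
  ring

theorem hasDerivAt_wA₂ {h : ℝ → ℝ} {r : ℝ} (hr : r ≠ 0)
    (h0 : HasDerivAt h (deriv h r) r) (h1 : HasDerivAt (deriv h) (deriv (deriv h) r) r) :
    HasDerivAt (wA₂ h) (wA₂' h r) r := by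
  have := (((hasDerivAt_id r).sub (h0.mul h1)).div (hasDerivAt_pow 3 r) (pow_ne_zero 3 hr))
  refine this.congr_deriv ?_
  simp only [wA₂', id, Pi.mul_apply, Pi.sub_apply]
  field_simp
  ring

theorem hasDerivAt_wA₃ {h : ℝ → ℝ} {r : ℝ} (hr : r ≠ 0)
    (h1 : HasDerivAt (wA₁ h) (wA₁' h r) r) (h2 : HasDerivAt (wA₂ h) (wA₂' h r) r) :
    HasDerivAt (wA₃ h) (wA₃' h r) r := by
  have := (h2.add (h1.const_mul 2)).neg.div (hasDerivAt_pow 2 r) (pow_ne_zero 2 hr)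
  refine this.congr_deriv ?_
  simp only [wA₃', Pi.neg_apply, Pi.add_apply]
  field_simp
  ring

theorem hasDerivAt_wA₄ {ψ : ℝ → ℝ} {r : ℝ} (hr : r ≠ 0)
    (h0 : HasDerivAt ψ (deriv ψ r) r) (h1 : HasDerivAt (deriv ψ) (deriv (deriv ψ) r) r) :
    HasDerivAt (wA₄ ψ) (wA₄' ψ r) r := by
  have := (h0.mul h1).neg.div (hasDerivAt_id r) hr
  refine this.congr_deriv ?_
  simp only [wA₄', id, Pi.neg_apply, Pi.mul_apply]
  field_simp
  ring

theorem hasDerivAt_wA₅ {ψ : ℝ → ℝ} {r : ℝ} (hr : r ≠ 0) (hψ : ψ r ≠ 0)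
    (h0 : HasDerivAt ψ (deriv ψ r) r) (h1 : HasDerivAt (deriv ψ) (deriv (deriv ψ) r) r) :
    HasDerivAt (wA₅ ψ) (wA₅' ψ r) r := by
  have := h1.div (h0.mul (hasDerivAt_id r)) (mul_ne_zero hψ hr)
  refine this.congr_deriv ?_
  simp only [wA₅', id, Pi.mul_apply]
  field_simp

variable {V₁ V₂ : Type*} [NormedAddCommGroup V₁] [InnerProductSpace ℝ V₁]
  [NormedAddCommGroup V₂] [InnerProductSpace ℝ V₂]
  [FiniteDimensional ℝ V₁] [FiniteDimensional ℝ V₂]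

theorem curvature_warped {x : V₁} (hx : x ≠ 0) {h ψ : ℝ → ℝ}
    (hd : ContDiff ℝ ∞ h) (hψd : ContDiff ℝ ∞ ψ)
    (hh : h ‖x‖ ≠ 0) (hψ : ψ ‖x‖ ≠ 0) {g : V₁ × V₂ → V₁ × V₂ →L[ℝ] V₁ × V₂ →L[ℝ] ℝ}
    (hgd : ContDiffAt ℝ ∞ g (x, 0))
    (hg : ∀ᶠ y in nhds (x, (0 : V₂)), ∀ V W, g y V W = warpedForm h ψ y V W) (U V : V₁ × V₂) :
    curvature g (x, 0) V V U
      = isoCurv (wA₁ h ‖x‖) (wA₂ h ‖x‖) (wA₃ h ‖x‖) (wA₄ ψ ‖x‖) (wA₅ ψ ‖x‖)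
          (wA₁' h ‖x‖) (wA₂' h ‖x‖) (wA₃' h ‖x‖) (wA₄' ψ ‖x‖) (wA₅' ψ ‖x‖) x U V := by
  have hr : ‖x‖ ≠ 0 := norm_ne_zero_iff.2 hx
  have hd' := (contDiff_infty_iff_deriv.1 hd).2
  have hψd' := (contDiff_infty_iff_deriv.1 hψd).2
  have d0 := ((hd.differentiable (by simp)) ‖x‖).hasDerivAt
  have d1 := ((hd'.differentiable (by simp)) ‖x‖).hasDerivAt
  have e0 := ((hψd.differentiable (by simp)) ‖x‖).hasDerivAt
  have e1 := ((hψd'.differentiable (by simp)) ‖x‖).hasDerivAt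
  have a1 := hasDerivAt_wA₁ hr hh d0 d1
  have a2 := hasDerivAt_wA₂ hr d0 d1
  have hinv : (g (x, 0)).IsInvertible := isInvertible_of_pos fun v hv => by
    rw [hg.self_of_nhds]; exact warpedForm_pos hx hh hψ hv
  have hcn : Continuous fun z : V₁ × V₂ => ‖z.1‖ := by fun_prop
  have hΓ : ∀ᶠ z in nhds (x, (0 : V₂)), ∀ V W, christoffel g z V W = warpedGamma h ψ z V W := by
    have c1 : ∀ᶠ z : V₁ × V₂ in nhds (x, (0 : V₂)), z.1 ≠ 0 :=
      continuous_fst.continuousAt.eventually_ne hx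
    have c2 : ∀ᶠ z : V₁ × V₂ in nhds (x, (0 : V₂)), h ‖z.1‖ ≠ 0 :=
      (hd.continuous.comp hcn).continuousAt.eventually_ne hh
    have c3 : ∀ᶠ z : V₁ × V₂ in nhds (x, (0 : V₂)), ψ ‖z.1‖ ≠ 0 :=
      (hψd.continuous.comp hcn).continuousAt.eventually_ne hψ
    have c4 : ∀ᶠ z in nhds (x, (0 : V₂)), ContDiffAt ℝ 1 g z :=
      (hgd.of_le (by norm_cast)).eventually (by simp)
    filter_upwards [c1, c2, c3, c4, hg.eventually_nhds] with z h1 h2 h3 h4 h5 V W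
    exact christoffel_warped h1 (hd.differentiable (by simp) _) (hψd.differentiable (by simp) _)
      h2 h3 (h4.differentiableAt (by simp)) h5 V W
  have hdiff : DifferentiableAt ℝ (christoffel g) (x, 0) :=
    (contDiffAt_christoffel hgd hinv).differentiableAt (by simp)
  have hder : ∀ U V W, fderiv ℝ (christoffel g) (x, 0) U V W = _ := fun U V W => by
    have h1 := hasDerivAt_clm_line hdiff U V W
    have h2 := hasDerivAt_isoGamma hx a1 a2 (hasDerivAt_wA₃ hr a1 a2) (hasDerivAt_wA₄ hr e0 e1)
      (hasDerivAt_wA₅ hr hψ e0 e1) U V W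
    refine h1.unique (h2.congr_of_eventuallyEq ?_)
    filter_upwards [eventually_line hΓ U] with t ht
    rw [ht]
    rfl
  rw [curvature_apply, hder, hder]
  simp only [hΓ.self_of_nhds]
  rfl

theorem sum_sum_radial {ι : Type*} [Fintype ι] [DecidableEq ι] (i₀ : ι) (a b : ℝ) :
    ∑ i, ∑ j, (if i = j then 0 else if i = i₀ ∨ j = i₀ then a else b)
      = 2 * (Fintype.card ι - 1) * a + (Fintype.card ι - 1) * (Fintype.card ι - 2) * b := by
  have h : ∀ i j : ι, (if i = j then 0 else if i = i₀ ∨ j = i₀ then a else b)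
      = b + (if i = j then -b else 0) + (if i = i₀ then a - b else 0)
        + (if j = i₀ then a - b else 0)
        + (if i = i₀ then (if j = i₀ then -(2 * (a - b)) else 0) else 0) := by
    intro i j
    by_cases h1 : i = j <;> by_cases h2 : i = i₀ <;> by_cases h3 : j = i₀ <;> simp_all
    ring
  simp only [h, Finset.sum_add_distrib, Finset.sum_ite_eq, Finset.sum_ite_eq', Finset.mem_univ,
    if_true, Finset.sum_const, Finset.card_univ, nsmul_eq_mul, Finset.sum_ite_irrel]
  simp only [← Finset.mul_sum, Finset.sum_ite_eq', Finset.mem_univ, if_true, mul_zero]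
  ring

theorem coordScalarCurvature_warped {ι₁ ι₂ : Type*} [Fintype ι₁] [Fintype ι₂] [DecidableEq ι₁]
    [DecidableEq ι₂] (b₁ : OrthonormalBasis ι₁ ℝ V₁) (b₂ : OrthonormalBasis ι₂ ℝ V₂) (i₀ : ι₁)
    {r : ℝ} (hr : 0 < r) {h ψ : ℝ → ℝ} (hd : ContDiff ℝ ∞ h) (hψd : ContDiff ℝ ∞ ψ)
    (hh : h r ≠ 0) (hψ : ψ r ≠ 0) {g : V₁ × V₂ → V₁ × V₂ →L[ℝ] V₁ × V₂ →L[ℝ] ℝ}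
    (hgd : ContDiffAt ℝ ∞ g (r • b₁ i₀, 0))
    (hg : ∀ᶠ y in nhds (r • b₁ i₀, (0 : V₂)), ∀ V W, g y V W = warpedForm h ψ y V W) :
    coordScalarCurvature g (r • b₁ i₀, 0)
      = warpedScal (Fintype.card ι₁) (Fintype.card ι₂) h ψ r := by
  have hu : ∀ i, ‖b₁ i‖ = 1 := b₁.orthonormal.1
  have hu₂ : ∀ i, ‖b₂ i‖ = 1 := b₂.orthonormal.1
  have ho : ∀ {i j}, i ≠ j → inner ℝ (b₁ i) (b₁ j) = 0 := fun hij => b₁.orthonormal.2 hij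
  have ho₂ : ∀ {i j}, i ≠ j → inner ℝ (b₂ i) (b₂ j) = 0 := fun hij => b₂.orthonormal.2 hij
  have hn : ‖r • b₁ i₀‖ = r := by rw [norm_smul, hu, mul_one, Real.norm_of_nonneg hr.le]
  have hx : r • b₁ i₀ ≠ 0 := norm_ne_zero_iff.1 (by rw [hn]; exact hr.ne')
  have hr' := hr.ne'
  have hinv : (g (r • b₁ i₀, 0)).IsInvertible := isInvertible_of_pos fun v hv => by
    rw [hg.self_of_nhds]
    exact warpedForm_pos hx (by rwa [hn]) (by rwa [hn]) hv
  have hcurv := curvature_warped hx hd hψd (by rwa [hn]) (by rwa [hn]) hgd hg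
  rw [hn] at hcurv
  let G : ι₁ ⊕ ι₂ → ℝ := Sum.elim (fun i => if i = i₀ then 1 else h r ^ 2 / r ^ 2)
    (fun _ => ψ r ^ 2)
  let κ : ι₁ ⊕ ι₂ → ι₁ ⊕ ι₂ → ℝ := Sum.elim
    (fun i => Sum.elim
      (fun j => if i = j then 0 else if i = i₀ ∨ j = i₀ then -deriv (deriv h) r / h r
        else (1 - deriv h r ^ 2) / h r ^ 2)
      (fun _ => if i = i₀ then -deriv (deriv ψ) r / ψ r
        else -(deriv h r * deriv ψ r) / (h r * ψ r)))
    (fun i => Sum.elim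
      (fun j => if j = i₀ then -deriv (deriv ψ) r / ψ r
        else -(deriv h r * deriv ψ r) / (h r * ψ r))
      (fun j => if i = j then 0 else (1 - deriv ψ r ^ 2) / ψ r ^ 2))
  rw [coordScalarCurvature_eq_sum (b₁.toBasis.prod b₂.toBasis) hinv G ?_ ?_ κ ?_]
  · simp only [Fintype.sum_sum_type, κ, Sum.elim_inl, Sum.elim_inr, Finset.sum_add_distrib,
      sum_sum_radial]
    have hs : ∀ a b : ℝ, ∑ i : ι₁, (if i = i₀ then a else b) = a + (Fintype.card ι₁ - 1) * b := by
      intro a b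
      have : ∀ i, (if i = i₀ then a else b) = b + (if i = i₀ then a - b else 0) := by
        intro i; split_ifs <;> ring
      simp only [this, Finset.sum_add_distrib, Finset.sum_ite_eq', Finset.mem_univ, if_true,
        Finset.sum_const, Finset.card_univ, nsmul_eq_mul]
      ring
    have hs₂ : ∀ a : ℝ, ∑ i : ι₂, ∑ j : ι₂, (if i = j then 0 else a)
        = Fintype.card ι₂ * (Fintype.card ι₂ - 1) * a := by
      intro a
      have : ∀ i j : ι₂, (if i = j then 0 else a) = a + (if i = j then -a else 0) := by
        intro i j; split_ifs <;> ring
      simp only [this, Finset.sum_add_distrib, Finset.sum_ite_eq, Finset.mem_univ, if_true,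
        Finset.sum_const, Finset.card_univ, nsmul_eq_mul]
      ring
    simp only [Finset.sum_const, Finset.card_univ, nsmul_eq_mul, ← Finset.mul_sum, hs, hs₂,
      warpedScal]
    ring
  · rintro (i | i)
    · simp only [G, Sum.elim_inl]; split_ifs <;> positivity
    · simp only [G, Sum.elim_inr]; positivity
  · rintro (i | i) (j | j)
    all_goals
      rw [hg.self_of_nhds]
      simp only [Module.Basis.prod_apply_inl_fst, Module.Basis.prod_apply_inl_snd,
        Module.Basis.prod_apply_inr_fst, Module.Basis.prod_apply_inr_snd, warpedForm, isoForm,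
        OrthonormalBasis.coe_toBasis, hn, real_inner_smul_left, inner_zero_left, inner_zero_right,
        conf_zero, G, Sum.elim_inl, Sum.elim_inr, Sum.inl.injEq, Sum.inr.injEq, reduceCtorEq,
        if_false, orthonormal_iff_ite.1 b₁.orthonormal, orthonormal_iff_ite.1 b₂.orthonormal]
    · by_cases h1 : i = j
      · subst h1
        by_cases h2 : i = i₀
        · subst h2; simp; field_simp; ring
        · have h3 : i₀ ≠ i := fun h => h2 h.symm
          simp [h2, h3]
      · by_cases h2 : i = i₀
        · subst h2; simp [h1]
        · have h3 : i₀ ≠ i := fun h => h2 h.symm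
          simp [h1, h3]
    · simp
    · simp
    · simp
  · have q1 : ∀ i, (b₁.toBasis.prod b₂.toBasis) (Sum.inl i) = (b₁ i, 0) := fun i => by
      ext1 <;> simp
    have q2 : ∀ i, (b₁.toBasis.prod b₂.toBasis) (Sum.inr i) = (0, b₂ i) := fun i => by
      ext1 <;> simp
    rintro (i | i) (j | j)
    · simp only [q1, hcurv, G, κ, Sum.elim_inl]
      by_cases h1 : i = j
      · subst h1; simp [isoCurv_self]
      · by_cases h2 : i = i₀
        · subst h2
          rw [isoCurv_tangential_radial _ _ _ _ _ _ _ _ _ _ hr (hu i) (ho h1)]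
          simp only [h1, if_false, true_or, if_true]
          congr 1
          simp only [wA₁, wA₂, wA₃, wA₁']
          field_simp
          ring
        · by_cases h3 : j = i₀
          · subst h3
            rw [isoCurv_radial_tangential _ _ _ _ _ _ _ _ _ _ hr (hu j) (ho (Ne.symm h2)) (hu i)]
            simp only [h1, if_false, or_true, if_true]
            congr 1
            simp only [wA₁, wA₂, wA₃, wA₂']
            field_simp
            ring
          · rw [isoCurv_tangential_tangential _ _ _ _ _ _ _ _ _ _ hr (hu i₀) (ho (Ne.symm h2))
              (hu i) (ho (Ne.symm h3)) (ho h1)]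
            simp only [h1, h2, h3, if_false, or_false]
            congr 1
            simp only [wA₁, wA₂]
            field_simp
            ring
    · simp only [q1, q2, hcurv, G, κ, Sum.elim_inl, Sum.elim_inr]
      by_cases h2 : i = i₀
      · subst h2
        rw [isoCurv_sphere_radial _ _ _ _ _ _ _ _ _ _ hr (hu i)]
        simp only [if_true]
        congr 1
        simp only [wA₁, wA₂, wA₃, wA₅, wA₅']
        field_simp
        ring
      · rw [isoCurv_sphere_tangential _ _ _ _ _ _ _ _ _ _ hr (hu i₀) (ho (Ne.symm h2)) (hu i)]
        simp only [h2, if_false]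
        congr 1
        simp only [wA₂, wA₅]
        field_simp
        ring
    · simp only [q1, q2, hcurv, G, κ, Sum.elim_inl, Sum.elim_inr]
      by_cases h2 : j = i₀
      · subst h2
        rw [isoCurv_radial_sphere _ _ _ _ _ _ _ _ _ _ hr (hu j) (hu₂ i)]
        simp only [if_true]
        congr 1
        simp only [wA₁, wA₂, wA₃, wA₄, wA₅, wA₄']
        field_simp
        ring
      · rw [isoCurv_tangential_sphere _ _ _ _ _ _ _ _ _ _ hr (hu i₀) (ho (Ne.symm h2)) (hu₂ i)]
        simp only [h2, if_false]
        congr 1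
        simp only [wA₁, wA₄]
        field_simp
        ring
    · simp only [q2, hcurv, G, κ, Sum.elim_inr]
      by_cases h1 : i = j
      · subst h1; simp [isoCurv_self]
      · rw [isoCurv_sphere_sphere _ _ _ _ _ _ _ _ _ _ hr (hu i₀) (hu₂ i) (ho₂ h1)]
        simp only [h1, if_false]
        congr 1
        simp only [wA₄, wA₅]
        field_simp
        try ring

end WarpedScalar

section Stereographic

theorem inner_fderiv_stereoInvFunAux {V W : Type*} [NormedAddCommGroup V] [InnerProductSpace ℝ V]
    [NormedAddCommGroup W] [InnerProductSpace ℝ W] (ι : V →ₗᵢ[ℝ] W) {v : W} (hv : ‖v‖ = 1)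
    (hι : ∀ b, inner ℝ (ι b) v = 0) (w b d : V) :
    inner ℝ (fderiv ℝ (fun w => stereoInvFunAux v (ι w)) w b)
      (fderiv ℝ (fun w => stereoInvFunAux v (ι w)) w d) = conf w ^ 2 * inner ℝ b d := by
  have hdiff : DifferentiableAt ℝ (fun w => stereoInvFunAux v (ι w)) w :=
    ((contDiff_stereoInvFunAux (m := 1)).comp ι.contDiff).differentiable (by simp) w
  have hN : ‖w‖ ^ 2 + 4 ≠ 0 := by positivity
  have hder : ∀ q, fderiv ℝ (fun w => stereoInvFunAux v (ι w)) w q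
      = (‖w‖ ^ 2 + 4)⁻¹ • ((4 : ℝ) • ι q + (2 * inner ℝ w q) • v)
        - (2 * inner ℝ w q / (‖w‖ ^ 2 + 4) ^ 2) • ((4 : ℝ) • ι w + (‖w‖ ^ 2 - 4) • v) := by
    intro q
    have hl := hasDerivAt_line w q
    have h1 : HasDerivAt (fun t : ℝ => stereoInvFunAux v (ι (w + t • q)))
        (fderiv ℝ (fun w => stereoInvFunAux v (ι w)) w q) 0 := by
      have h2 : HasFDerivAt (fun w => stereoInvFunAux v (ι w))
          (fderiv ℝ (fun w => stereoInvFunAux v (ι w)) w) (w + (0 : ℝ) • q) := by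
        simpa using hdiff.hasFDerivAt
      exact h2.comp_hasDerivAt (0 : ℝ) hl
    have h3 : HasDerivAt (fun t : ℝ => ι (w + t • q)) (ι q) 0 :=
      ι.toContinuousLinearMap.hasFDerivAt.comp_hasDerivAt (0 : ℝ) hl
    have h4 := (hl.norm_sq.add_const 4).inv (by positivity)
    have h5 := h4.smul ((h3.const_smul (4 : ℝ)).add ((hl.norm_sq.sub_const 4).smul_const v))
    refine (h1.unique (h5.congr_of_eventuallyEq (Filter.Eventually.of_forall fun t => ?_))).trans ?_
    · simp only [stereoInvFunAux_apply, ι.norm_map, Pi.smul_apply', Pi.smul_apply, Pi.add_apply,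
        Pi.inv_apply]
    simp only [zero_smul, add_zero, Pi.add_apply, Pi.inv_apply, Pi.smul_apply]
    module
  have hι' : ∀ b, inner ℝ v (ι b) = 0 := fun b => by rw [real_inner_comm, hι]
  rw [hder, hder]
  simp only [inner_sub_left, inner_sub_right, inner_add_left, inner_add_right,
    real_inner_smul_left, real_inner_smul_right, ι.inner_map_map, hι, hι',
    real_inner_self_eq_norm_sq, hv, conf]
  rw [real_inner_comm w b]
  generalize inner ℝ w b = p
  generalize inner ℝ w d = q
  generalize inner ℝ b d = s
  generalize ‖w‖ ^ 2 = ρ at *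
  field_simp
  ring

variable {m : ℕ}

theorem coe_extChartAt_symm_sphere (y : Sph m) :
    ∃ ι : EuclideanSpace ℝ (Fin m) →ₗᵢ[ℝ] EuclideanSpace ℝ (Fin (m + 1)),
      ∃ v : EuclideanSpace ℝ (Fin (m + 1)), ‖v‖ = 1 ∧ (∀ b, inner ℝ (ι b) v = 0) ∧
      ∀ w, ((extChartAt (𝓡 m) y).symm w : EuclideanSpace ℝ (Fin (m + 1)))
        = stereoInvFunAux v (ι w) := by
  have hne := ne_zero_of_mem_unit_sphere (-y)
  have := Fact.mk (@finrank_euclideanSpace_fin ℝ _ (m + 1))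
  let U : (ℝ ∙ ((-y : Sph m) : EuclideanSpace ℝ (Fin (m + 1))))ᗮ ≃ₗᵢ[ℝ] EuclideanSpace ℝ (Fin m) :=
    (OrthonormalBasis.fromOrthogonalSpanSingleton m hne).repr
  refine ⟨(Submodule.subtypeₗᵢ _).comp U.symm.toLinearIsometry, (-y : Sph m),
    norm_eq_of_mem_sphere _, ?_, ?_⟩
  · intro b
    exact Submodule.mem_orthogonal_singleton_iff_inner_left.1 (U.symm b).2
  · intro w
    refine (stereographic'_symm_apply (-y) w).trans ?_
    simp only [stereoInvFunAux_apply, smul_add]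
    rfl

theorem extChartAt_sphere_target (y : Sph m) : (extChartAt (𝓡 m) y).target = univ := by
  have := Fact.mk (@finrank_euclideanSpace_fin ℝ _ (m + 1))
  have : (chartAt (EuclideanSpace ℝ (Fin m)) y).target = univ := stereographic'_target (-y)
  simp [extChartAt, this]

theorem extChartAt_sphere_self (y : Sph m) : extChartAt (𝓡 m) y y = 0 := by
  have := Fact.mk (@finrank_euclideanSpace_fin ℝ _ (m + 1))
  exact (congrArg (OrthonormalBasis.fromOrthogonalSpanSingleton m
    (ne_zero_of_mem_unit_sphere (-y))).repr (stereographic_neg_apply y)).trans (map_zero _)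

theorem mdifferentiableAt_extChartAt_symm_sphere (y : Sph m) (w : EuclideanSpace ℝ (Fin m)) :
    MDifferentiableAt 𝓘(ℝ, EuclideanSpace ℝ (Fin m)) (𝓡 m) (extChartAt (𝓡 m) y).symm w := by
  have : IsManifold (𝓡 m) 1 (Sph m) := IsManifold.of_le (n := ω) le_top
  have h := contMDiffOn_extChartAt_symm (I := 𝓡 m) (n := 1) y
  rw [extChartAt_sphere_target] at h
  exact ((h w (mem_univ w)).contMDiffAt Filter.univ_mem).mdifferentiableAt (by simp)

theorem mdifferentiableAt_coe_sphere (y : Sph m) :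
    MDifferentiableAt (𝓡 m) 𝓘(ℝ, EuclideanSpace ℝ (Fin (m + 1)))
      (fun q : Sph m => (q : EuclideanSpace ℝ (Fin (m + 1)))) y := by
  have := Fact.mk (@finrank_euclideanSpace_fin ℝ _ (m + 1))
  exact (contMDiff_coe_sphere (m := 1)).mdifferentiable (by simp) _

theorem mfderiv_coe_comp_extChartAt_symm (y : Sph m) (w : EuclideanSpace ℝ (Fin m)) :
    mfderiv 𝓘(ℝ, EuclideanSpace ℝ (Fin m)) 𝓘(ℝ, EuclideanSpace ℝ (Fin (m + 1)))
      ((fun q : Sph m => (q : EuclideanSpace ℝ (Fin (m + 1)))) ∘ (extChartAt (𝓡 m) y).symm) w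
    = (mfderiv (𝓡 m) 𝓘(ℝ, EuclideanSpace ℝ (Fin (m + 1)))
        (fun q : Sph m => (q : EuclideanSpace ℝ (Fin (m + 1)))) ((extChartAt (𝓡 m) y).symm w)).comp
      (mfderiv 𝓘(ℝ, EuclideanSpace ℝ (Fin m)) (𝓡 m) (extChartAt (𝓡 m) y).symm w) :=
  mfderiv_comp w (mdifferentiableAt_coe_sphere _) (mdifferentiableAt_extChartAt_symm_sphere y w)

theorem fderiv_eq_of_mfderiv_eq {E F : Type*} [NormedAddCommGroup E] [NormedSpace ℝ E]
    [NormedAddCommGroup F] [NormedSpace ℝ F] {f f' : E → F} {w : E} {L : E →L[ℝ] F}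
    (h : mfderiv 𝓘(ℝ, E) 𝓘(ℝ, F) f w = L) (hf : f = f') : fderiv ℝ f' w = L := by
  subst hf
  rw [← mfderiv_eq_fderiv]
  exact h

theorem bilinearComp_euclid_apply_comp {V W : Type*} [NormedAddCommGroup V] [NormedSpace ℝ V]
    [NormedAddCommGroup W] [NormedSpace ℝ W] {k : ℕ}
    {L : V →L[ℝ] EuclideanSpace ℝ (Fin k)} {M : W →L[ℝ] V} {N : W →L[ℝ] EuclideanSpace ℝ (Fin k)}
    (h : N = L.comp M) (b d : W) :
    (euclid k).bilinearComp L L (M b) (M d) = inner ℝ (N b) (N d) := by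
  subst h
  rfl

theorem roundMetric_extChartAt_symm (y : Sph m) (w b d : EuclideanSpace ℝ (Fin m)) :
    (roundMetric ((extChartAt (𝓡 m) y).symm w) :
        EuclideanSpace ℝ (Fin m) →L[ℝ] EuclideanSpace ℝ (Fin m) →L[ℝ] ℝ)
      ((mfderiv 𝓘(ℝ, EuclideanSpace ℝ (Fin m)) (𝓡 m) (extChartAt (𝓡 m) y).symm w :
        EuclideanSpace ℝ (Fin m) →L[ℝ] EuclideanSpace ℝ (Fin m)) b)
      ((mfderiv 𝓘(ℝ, EuclideanSpace ℝ (Fin m)) (𝓡 m) (extChartAt (𝓡 m) y).symm w :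
        EuclideanSpace ℝ (Fin m) →L[ℝ] EuclideanSpace ℝ (Fin m)) d)
      = conf w ^ 2 * inner ℝ b d := by
  obtain ⟨ι, v, hv, hι, hS⟩ := coe_extChartAt_symm_sphere y
  let Lc : EuclideanSpace ℝ (Fin m) →L[ℝ] EuclideanSpace ℝ (Fin (m + 1)) :=
    mfderiv (𝓡 m) 𝓘(ℝ, EuclideanSpace ℝ (Fin (m + 1)))
      (fun q : Sph m => (q : EuclideanSpace ℝ (Fin (m + 1)))) ((extChartAt (𝓡 m) y).symm w)
  let Lσ : EuclideanSpace ℝ (Fin m) →L[ℝ] EuclideanSpace ℝ (Fin m) :=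
    mfderiv 𝓘(ℝ, EuclideanSpace ℝ (Fin m)) (𝓡 m) (extChartAt (𝓡 m) y).symm w
  have h : fderiv ℝ (fun w => stereoInvFunAux v (ι w)) w = Lc.comp Lσ :=
    fderiv_eq_of_mfderiv_eq (mfderiv_coe_comp_extChartAt_symm y w) (funext hS)
  exact (bilinearComp_euclid_apply_comp h b d).trans (inner_fderiv_stereoInvFunAux ι hv hι w b d)

end Stereographic

theorem inChart_apply {E : Type*} [NormedAddCommGroup E] [NormedSpace ℝ E] {H : Type*}
    [TopologicalSpace H] {I : ModelWithCorners ℝ E H} {M : Type*} [TopologicalSpace M]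
    [ChartedSpace H M] (g : TwoTensor I M) (p : M) (z : E) {L : E →L[ℝ] E} {q : M}
    {B : E →L[ℝ] E →L[ℝ] ℝ} (hL : (mfderiv 𝓘(ℝ, E) I (extChartAt I p).symm z : E →L[ℝ] E) = L)
    (hq : (extChartAt I p).symm z = q) (hB : g q = B) (V W : E) :
    inChart g p z V W = B (L V) (L W) := by
  subst hL hq hB
  rfl

section InChart

variable {n m : ℕ}

theorem extChartAt_model_symm (p : EuclideanSpace ℝ (Fin n) × Sph m) :
    ((extChartAt (model n m) p).symm : EuclideanSpace ℝ (Fin n) × EuclideanSpace ℝ (Fin m) →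
      EuclideanSpace ℝ (Fin n) × Sph m)
      = fun z => (z.1, (extChartAt (𝓡 m) p.2).symm z.2) := by
  rw [extChartAt_prod]
  rfl

theorem extChartAt_model_self (p : EuclideanSpace ℝ (Fin n) × Sph m) :
    (extChartAt (model n m) p p : EuclideanSpace ℝ (Fin n) × EuclideanSpace ℝ (Fin m))
      = (p.1, 0) := by
  rw [extChartAt_prod]
  exact Prod.ext rfl (extChartAt_sphere_self p.2)

/-- The differential of the inverse of the chart of the sphere. -/
def chartSymmDeriv (y : Sph m) (w : EuclideanSpace ℝ (Fin m)) :
    EuclideanSpace ℝ (Fin m) →L[ℝ] EuclideanSpace ℝ (Fin m) :=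
  mfderiv 𝓘(ℝ, EuclideanSpace ℝ (Fin m)) (𝓡 m) (extChartAt (𝓡 m) y).symm w

theorem mfderiv_extChartAt_model_symm (p : EuclideanSpace ℝ (Fin n) × Sph m)
    (z : EuclideanSpace ℝ (Fin n) × EuclideanSpace ℝ (Fin m)) :
    (mfderiv 𝓘(ℝ, EuclideanSpace ℝ (Fin n) × EuclideanSpace ℝ (Fin m)) (model n m)
      (fun z : EuclideanSpace ℝ (Fin n) × EuclideanSpace ℝ (Fin m) =>
        (z.1, (extChartAt (𝓡 m) p.2).symm z.2)) z :
      EuclideanSpace ℝ (Fin n) × EuclideanSpace ℝ (Fin m) →L[ℝ]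
        EuclideanSpace ℝ (Fin n) × EuclideanSpace ℝ (Fin m))
      = (ContinuousLinearMap.fst ℝ (EuclideanSpace ℝ (Fin n)) (EuclideanSpace ℝ (Fin m))).prod
        ((chartSymmDeriv p.2 z.2).comp
          (ContinuousLinearMap.snd ℝ (EuclideanSpace ℝ (Fin n)) (EuclideanSpace ℝ (Fin m)))) := by
  have h1 : HasMFDerivAt 𝓘(ℝ, EuclideanSpace ℝ (Fin n) × EuclideanSpace ℝ (Fin m))
      𝓘(ℝ, EuclideanSpace ℝ (Fin n))
      (fun z : EuclideanSpace ℝ (Fin n) × EuclideanSpace ℝ (Fin m) => z.1) z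
      (ContinuousLinearMap.fst ℝ (EuclideanSpace ℝ (Fin n)) (EuclideanSpace ℝ (Fin m))) :=
    hasFDerivAt_fst.hasMFDerivAt
  have h2 : HasMFDerivAt 𝓘(ℝ, EuclideanSpace ℝ (Fin n) × EuclideanSpace ℝ (Fin m))
      𝓘(ℝ, EuclideanSpace ℝ (Fin m))
      (fun z : EuclideanSpace ℝ (Fin n) × EuclideanSpace ℝ (Fin m) => z.2) z
      (ContinuousLinearMap.snd ℝ (EuclideanSpace ℝ (Fin n)) (EuclideanSpace ℝ (Fin m))) :=
    hasFDerivAt_snd.hasMFDerivAt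
  have h3 := (mdifferentiableAt_extChartAt_symm_sphere p.2 z.2).hasMFDerivAt
  exact (h1.prodMk (h3.comp z h2)).mfderiv

theorem inChart_doublyWarped (h ψ : ℝ → ℝ) (p : EuclideanSpace ℝ (Fin n) × Sph m)
    (z V W : EuclideanSpace ℝ (Fin n) × EuclideanSpace ℝ (Fin m)) :
    inChart (doublyWarped n m h ψ) p z V W
      = polarMetric h z.1 V.1 W.1 + ψ ‖z.1‖ ^ 2 * (conf z.2 ^ 2 * inner ℝ V.2 W.2) := by
  have hσ := extChartAt_model_symm p
  let L : EuclideanSpace ℝ (Fin n) × EuclideanSpace ℝ (Fin m) →L[ℝ]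
      EuclideanSpace ℝ (Fin n) × EuclideanSpace ℝ (Fin m) :=
    mfderiv 𝓘(ℝ, EuclideanSpace ℝ (Fin n) × EuclideanSpace ℝ (Fin m)) (model n m)
      (extChartAt (model n m) p).symm z
  have hL : L = (ContinuousLinearMap.fst ℝ (EuclideanSpace ℝ (Fin n))
        (EuclideanSpace ℝ (Fin m))).prod
      ((chartSymmDeriv p.2 z.2).comp
        (ContinuousLinearMap.snd ℝ (EuclideanSpace ℝ (Fin n)) (EuclideanSpace ℝ (Fin m)))) := by
    rw [← mfderiv_extChartAt_model_symm p z, ← hσ]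
  refine (inChart_apply (doublyWarped n m h ψ) p z hL (congrFun hσ z) rfl V W).trans ?_
  rw [← roundMetric_extChartAt_symm p.2 z.2]
  rfl

end InChart

section SinSquared

/-- The Taylor coefficients of `ρ ↦ cos (2 √ρ)`. -/
def cosSqrtCoeff (k : ℕ) : ℝ := (-4) ^ k / (2 * k).factorial

theorem cosSqrtCoeff_succ (k : ℕ) :
    cosSqrtCoeff (k + 1) = cosSqrtCoeff k * (-4 / ((2 * k + 2) * (2 * k + 1))) := by
  have h : ((2 * (k + 1)).factorial : ℝ) = (2 * k + 2) * ((2 * k + 1) * (2 * k).factorial) := by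
    rw [show 2 * (k + 1) = 2 * k + 1 + 1 by ring, Nat.factorial_succ, Nat.factorial_succ]
    push_cast; ring
  have h2 : ((2 * k).factorial : ℝ) ≠ 0 := by positivity
  have h3 : (2 * k + 2 : ℝ) ≠ 0 := by positivity
  have h4 : (2 * k + 1 : ℝ) ≠ 0 := by positivity
  rw [cosSqrtCoeff, cosSqrtCoeff, h]
  field_simp
  ring

theorem cosSqrtCoeff_ne_zero (k : ℕ) : cosSqrtCoeff k ≠ 0 := by
  unfold cosSqrtCoeff; positivity

/-- The entire function `ρ ↦ cos (2 √ρ)`. -/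
def cosSqrt : ℝ → ℝ := (FormalMultilinearSeries.ofScalars ℝ cosSqrtCoeff).sum

theorem hasFPowerSeriesAt_cosSqrt :
    HasFPowerSeriesAt cosSqrt (FormalMultilinearSeries.ofScalars ℝ cosSqrtCoeff) 0 := by
  have hrad : (FormalMultilinearSeries.ofScalars ℝ cosSqrtCoeff).radius = ⊤ := by
    refine FormalMultilinearSeries.ofScalars_radius_eq_top_of_tendsto ℝ cosSqrtCoeff
      (Filter.Eventually.of_forall cosSqrtCoeff_ne_zero) ?_
    have h1 : ∀ k : ℕ, ‖cosSqrtCoeff k.succ‖ / ‖cosSqrtCoeff k‖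
        = ‖(-4 : ℝ) / ((2 * k + 2) * (2 * k + 1))‖ := by
      intro k
      rw [Nat.succ_eq_add_one, cosSqrtCoeff_succ, norm_mul,
        mul_div_cancel_left₀ _ (norm_ne_zero_iff.2 (cosSqrtCoeff_ne_zero k))]
    simp only [h1]
    refine tendsto_zero_iff_norm_tendsto_zero.1 ?_
    refine tendsto_const_nhds.div_atTop (Filter.tendsto_atTop_mono (fun k => ?_)
      (tendsto_natCast_atTop_atTop (R := ℝ)))
    have : (0 : ℝ) ≤ k := k.cast_nonneg
    nlinarith
  exact (FormalMultilinearSeries.hasFPowerSeriesOnBall _ (by simp [hrad])).hasFPowerSeriesAt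

theorem cosSqrt_sq (r : ℝ) : cosSqrt (r ^ 2) = Real.cos (2 * r) := by
  have h : cosSqrt (r ^ 2) = ∑' k, cosSqrtCoeff k • (r ^ 2) ^ k :=
    FormalMultilinearSeries.ofScalars_sum_eq cosSqrtCoeff (r ^ 2)
  rw [h, ← (Real.hasSum_cos (2 * r)).tsum_eq]
  refine tsum_congr fun k => ?_
  rw [cosSqrtCoeff, smul_eq_mul, mul_pow, pow_mul, pow_mul, ← pow_mul r]
  rw [show (-4 : ℝ) = -1 * 2 ^ 2 by norm_num, mul_pow]
  ring

/-- The entire function with `sinSqQuot (r ^ 2) = (sin r / r) ^ 2`. -/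
def sinSqQuot (ρ : ℝ) : ℝ := -(1 / 2) * dslope cosSqrt 0 ρ

theorem analyticAt_sinSqQuot : AnalyticAt ℝ sinSqQuot 0 :=
  analyticAt_const.mul hasFPowerSeriesAt_cosSqrt.has_fpower_series_dslope_fslope.analyticAt

theorem sinSqQuot_zero : sinSqQuot 0 = 1 := by
  rw [sinSqQuot, dslope_same, hasFPowerSeriesAt_cosSqrt.deriv,
    FormalMultilinearSeries.ofScalars_apply_eq]
  norm_num [cosSqrtCoeff]

theorem sinSqQuot_sq {r : ℝ} (hr : r ≠ 0) : sinSqQuot (r ^ 2) = Real.sin r ^ 2 / r ^ 2 := by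
  have h0 : cosSqrt 0 = 1 := by simpa using cosSqrt_sq 0
  rw [sinSqQuot, dslope_of_ne _ (pow_ne_zero 2 hr), slope_def_field, cosSqrt_sq, h0,
    Real.cos_two_mul, Real.cos_sq']
  field_simp
  ring

theorem contDiffAt_dslope_sinSqQuot : ContDiffAt ℝ ∞ (dslope sinSqQuot 0) 0 := by
  obtain ⟨p, hp⟩ := analyticAt_sinSqQuot
  exact hp.has_fpower_series_dslope_fslope.analyticAt.contDiffAt

end SinSquared

section Smoothness

variable {n m : ℕ}

theorem polarMetric_apply {x : EuclideanSpace ℝ (Fin n)} (hx : x ≠ 0) (h : ℝ → ℝ)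
    (a c : EuclideanSpace ℝ (Fin n)) :
    polarMetric h x a c = h ‖x‖ ^ 2 / ‖x‖ ^ 2 * inner ℝ a c
      + (1 - h ‖x‖ ^ 2 / ‖x‖ ^ 2) / ‖x‖ ^ 2 * (inner ℝ x a * inner ℝ x c) := by
  have hr : ‖x‖ ≠ 0 := norm_ne_zero_iff.2 hx
  rw [polarMetric, if_neg hx]
  simp [dr, angular, euclid_apply]
  field_simp
  ring

theorem polarMetric_zero (h : ℝ → ℝ) : polarMetric h (0 : EuclideanSpace ℝ (Fin n)) = euclid n :=
  if_pos rfl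

theorem polarMetric_congr {h h' : ℝ → ℝ} {x : EuclideanSpace ℝ (Fin n)} (hx : h ‖x‖ = h' ‖x‖) :
    polarMetric h x = polarMetric h' x := by
  simp only [polarMetric, hx]

theorem doublyWarped_congr {h h' ψ : ℝ → ℝ} {p : EuclideanSpace ℝ (Fin n) × Sph m}
    (hp : h ‖p.1‖ = h' ‖p.1‖) : doublyWarped n m h ψ p = doublyWarped n m h' ψ p := by
  simp only [doublyWarped, polarMetric_congr hp]
  rfl

variable (n m) in
/-- The linear map `x ↦ ((a, b) ↦ ⟨x, a⟩)`. -/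
def innerFst : EuclideanSpace ℝ (Fin n) →L[ℝ]
    (EuclideanSpace ℝ (Fin n) × EuclideanSpace ℝ (Fin m)) →L[ℝ] ℝ :=
  ((ContinuousLinearMap.compL ℝ _ _ ℝ).flip
    (ContinuousLinearMap.fst ℝ (EuclideanSpace ℝ (Fin n)) (EuclideanSpace ℝ (Fin m)))) ∘L euclid n

/-- The form `a |dx|² + b ⟨x, dx⟩² + c |dw|²`. -/
def isoMetric (a b c : ℝ) (x : EuclideanSpace ℝ (Fin n)) :
    (EuclideanSpace ℝ (Fin n) × EuclideanSpace ℝ (Fin m)) →L[ℝ]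
      (EuclideanSpace ℝ (Fin n) × EuclideanSpace ℝ (Fin m)) →L[ℝ] ℝ :=
  a • (euclid n).bilinearComp (ContinuousLinearMap.fst ℝ _ _) (ContinuousLinearMap.fst ℝ _ _)
    + b • (innerFst n m x).smulRight (innerFst n m x)
    + c • (euclid m).bilinearComp (ContinuousLinearMap.snd ℝ _ _) (ContinuousLinearMap.snd ℝ _ _)

theorem isoMetric_apply (a b c : ℝ) (x : EuclideanSpace ℝ (Fin n))
    (V W : EuclideanSpace ℝ (Fin n) × EuclideanSpace ℝ (Fin m)) :
    isoMetric a b c x V W = a * inner ℝ V.1 W.1 + b * (inner ℝ x V.1 * inner ℝ x W.1)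
      + c * inner ℝ V.2 W.2 := by
  simp [isoMetric, innerFst, euclid_apply]

theorem contDiffAt_isoMetric {F : Type*} [NormedAddCommGroup F] [NormedSpace ℝ F]
    {a b c : F → ℝ} {x : F → EuclideanSpace ℝ (Fin n)} {q : F}
    (ha : ContDiffAt ℝ ∞ a q) (hb : ContDiffAt ℝ ∞ b q) (hc : ContDiffAt ℝ ∞ c q)
    (hx : ContDiffAt ℝ ∞ x q) :
    ContDiffAt ℝ ∞ (fun y => isoMetric (m := m) (a y) (b y) (c y) (x y)) q := by
  have hl : ContDiffAt ℝ ∞ (fun y => innerFst n m (x y)) q :=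
    (innerFst n m).contDiff.contDiffAt.comp q hx
  unfold isoMetric
  exact ((ha.smul contDiffAt_const).add (hb.smul (hl.smulRight hl))).add (hc.smul contDiffAt_const)

theorem inChart_doublyWarped_of_ne (h ψ : ℝ → ℝ) (p : EuclideanSpace ℝ (Fin n) × Sph m)
    {z : EuclideanSpace ℝ (Fin n) × EuclideanSpace ℝ (Fin m)} (hz : z.1 ≠ 0) :
    inChart (doublyWarped n m h ψ) p z = isoMetric (h ‖z.1‖ ^ 2 / ‖z.1‖ ^ 2)
      ((1 - h ‖z.1‖ ^ 2 / ‖z.1‖ ^ 2) / ‖z.1‖ ^ 2) (ψ ‖z.1‖ ^ 2 * conf z.2 ^ 2) z.1 := by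
  refine ContinuousLinearMap.ext fun V => ContinuousLinearMap.ext fun W => ?_
  rw [inChart_doublyWarped, polarMetric_apply hz, isoMetric_apply]
  ring

theorem inChart_doublyWarped_of_sin {h : ℝ → ℝ} (ψ : ℝ → ℝ)
    (p : EuclideanSpace ℝ (Fin n) × Sph m)
    {z : EuclideanSpace ℝ (Fin n) × EuclideanSpace ℝ (Fin m)} (hz : h ‖z.1‖ = Real.sin ‖z.1‖) :
    inChart (doublyWarped n m h ψ) p z = isoMetric (sinSqQuot (‖z.1‖ ^ 2))
      (-dslope sinSqQuot 0 (‖z.1‖ ^ 2)) (ψ ‖z.1‖ ^ 2 * conf z.2 ^ 2) z.1 := by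
  by_cases h0 : z.1 = 0
  · refine ContinuousLinearMap.ext fun V => ContinuousLinearMap.ext fun W => ?_
    rw [inChart_doublyWarped, isoMetric_apply, h0, polarMetric_zero, euclid_apply]
    simp [sinSqQuot_zero]
    ring
  · have hr : ‖z.1‖ ≠ 0 := norm_ne_zero_iff.2 h0
    rw [inChart_doublyWarped_of_ne _ _ _ h0, hz, sinSqQuot_sq hr,
      dslope_of_ne _ (pow_ne_zero 2 hr), slope_def_field, sinSqQuot_zero, sinSqQuot_sq hr]
    congr 1
    field_simp
    ring

theorem contDiff_conf {V : Type*} [NormedAddCommGroup V] [InnerProductSpace ℝ V] :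
    ContDiff ℝ ∞ (conf : V → ℝ) := by
  unfold conf
  exact contDiff_const.div ((contDiff_norm_sq ℝ).add contDiff_const) fun w => by positivity

/-- Joint smoothness of a family of doubly warped product metrics away from the centre. -/
theorem contDiffAt_inChart_of_ne {H : ℝ → ℝ → ℝ} {ψ : ℝ → ℝ}
    (hH : ContDiff ℝ ∞ (fun q : ℝ × ℝ => H q.1 q.2)) (hψ : ContDiff ℝ ∞ ψ)
    (p : EuclideanSpace ℝ (Fin n) × Sph m) (τ : ℝ)
    {z : EuclideanSpace ℝ (Fin n) × EuclideanSpace ℝ (Fin m)} (hz : z.1 ≠ 0) :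
    ContDiffAt ℝ ∞ (fun q : ℝ × (EuclideanSpace ℝ (Fin n) × EuclideanSpace ℝ (Fin m)) =>
      inChart (doublyWarped n m (H q.1) ψ) p q.2) (τ, z) := by
  have hx : ContDiffAt ℝ ∞
      (fun q : ℝ × (EuclideanSpace ℝ (Fin n) × EuclideanSpace ℝ (Fin m)) => q.2.1) (τ, z) :=
    contDiffAt_snd.fst
  have hr : ContDiffAt ℝ ∞
      (fun q : ℝ × (EuclideanSpace ℝ (Fin n) × EuclideanSpace ℝ (Fin m)) => ‖q.2.1‖) (τ, z) :=
    hx.norm ℝ hz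
  have hr0 : ‖z.1‖ ≠ 0 := norm_ne_zero_iff.2 hz
  have hHq : ContDiffAt ℝ ∞
      (fun q : ℝ × (EuclideanSpace ℝ (Fin n) × EuclideanSpace ℝ (Fin m)) => H q.1 ‖q.2.1‖)
      (τ, z) :=
    hH.contDiffAt.comp (τ, z) (contDiffAt_fst.prodMk hr)
  have ha := (hHq.pow 2).div (hr.pow 2) (pow_ne_zero 2 hr0)
  have hb := (contDiffAt_const (c := (1 : ℝ))).sub ha |>.div (hr.pow 2) (pow_ne_zero 2 hr0)
  have hc : ContDiffAt ℝ ∞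
      (fun q : ℝ × (EuclideanSpace ℝ (Fin n) × EuclideanSpace ℝ (Fin m)) =>
        ψ ‖q.2.1‖ ^ 2 * conf q.2.2 ^ 2) (τ, z) :=
    ((hψ.contDiffAt.comp (τ, z) hr).pow 2).mul
      ((contDiff_conf.contDiffAt.comp (τ, z) contDiffAt_snd.snd).pow 2)
  refine (contDiffAt_isoMetric (m := m) ha hb hc hx).congr_of_eventuallyEq ?_
  filter_upwards [hx.continuousAt.eventually_ne hz] with q hq
  exact inChart_doublyWarped_of_ne _ _ _ hq

/-- Joint smoothness of a family of doubly warped product metrics near the centre. -/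
theorem contDiffAt_inChart_of_sin {H : ℝ → ℝ → ℝ} {ψ : ℝ → ℝ} {ε c : ℝ} (hε : 0 < ε)
    (hH : ∀ τ, ∀ r ∈ Ico 0 ε, H τ r = Real.sin r) (hψ : ∀ r ∈ Ico 0 ε, ψ r = c)
    (p : EuclideanSpace ℝ (Fin n) × Sph m) (τ : ℝ)
    {z : EuclideanSpace ℝ (Fin n) × EuclideanSpace ℝ (Fin m)} (hz : z.1 = 0) :
    ContDiffAt ℝ ∞ (fun q : ℝ × (EuclideanSpace ℝ (Fin n) × EuclideanSpace ℝ (Fin m)) =>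
      inChart (doublyWarped n m (H q.1) ψ) p q.2) (τ, z) := by
  have hx : ContDiffAt ℝ ∞
      (fun q : ℝ × (EuclideanSpace ℝ (Fin n) × EuclideanSpace ℝ (Fin m)) => q.2.1) (τ, z) :=
    contDiffAt_snd.fst
  have hr : ContDiffAt ℝ ∞
      (fun q : ℝ × (EuclideanSpace ℝ (Fin n) × EuclideanSpace ℝ (Fin m)) => ‖q.2.1‖ ^ 2) (τ, z) :=
    hx.norm_sq ℝ
  have h0 : ‖(τ, z).2.1‖ ^ 2 = 0 := by simp [hz]
  have ha : ContDiffAt ℝ ∞ (fun q : ℝ × (EuclideanSpace ℝ (Fin n) × EuclideanSpace ℝ (Fin m)) =>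
      sinSqQuot (‖q.2.1‖ ^ 2)) (τ, z) :=
    ContDiffAt.comp (g := sinSqQuot) (τ, z) (by rw [h0]; exact analyticAt_sinSqQuot.contDiffAt) hr
  have hb : ContDiffAt ℝ ∞ (fun q : ℝ × (EuclideanSpace ℝ (Fin n) × EuclideanSpace ℝ (Fin m)) =>
      -dslope sinSqQuot 0 (‖q.2.1‖ ^ 2)) (τ, z) :=
    (ContDiffAt.comp (τ, z) (by rw [h0]; exact contDiffAt_dslope_sinSqQuot) hr).neg
  have hc : ContDiffAt ℝ ∞
      (fun q : ℝ × (EuclideanSpace ℝ (Fin n) × EuclideanSpace ℝ (Fin m)) =>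
        c ^ 2 * conf q.2.2 ^ 2) (τ, z) :=
    contDiffAt_const.mul ((contDiff_conf.contDiffAt.comp (τ, z) contDiffAt_snd.snd).pow 2)
  refine (contDiffAt_isoMetric (m := m) ha hb hc hx).congr_of_eventuallyEq ?_
  have hlt : ∀ᶠ q in nhds (τ, z), ‖q.2.1‖ < ε :=
    hx.continuousAt.norm.eventually_lt_const (by simpa [hz] using hε)
  filter_upwards [hlt] with q hq
  rw [inChart_doublyWarped_of_sin ψ p (hH q.1 _ ⟨norm_nonneg _, hq⟩), hψ _ ⟨norm_nonneg _, hq⟩]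

end Smoothness

section Positivity

variable {n m : ℕ}

theorem polarMetric_pos {h : ℝ → ℝ} {x a : EuclideanSpace ℝ (Fin n)} (hx : x ≠ 0 → h ‖x‖ ≠ 0)
    (ha : a ≠ 0) : 0 < polarMetric h x a a := by
  by_cases h0 : x = 0
  · rw [h0, polarMetric_zero, euclid_apply]
    exact real_inner_self_pos.2 ha
  · have := warpedForm_pos (V₂ := ℝ) (h := h) (ψ := fun _ => 1) (z := (x, 0)) (V := (a, 0)) h0
      (hx h0) one_ne_zero (fun h => ha (congrArg Prod.fst h))
    simpa [polarMetric_apply h0, warpedForm, isoForm] using this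

theorem polarMetric_symm (h : ℝ → ℝ) (x a c : EuclideanSpace ℝ (Fin n)) :
    polarMetric h x a c = polarMetric h x c a := by
  by_cases h0 : x = 0
  · rw [h0, polarMetric_zero, euclid_apply, euclid_apply, real_inner_comm]
  · rw [polarMetric_apply h0, polarMetric_apply h0, real_inner_comm]
    ring

theorem roundMetric_symm (y : Sph m) (b d : EuclideanSpace ℝ (Fin m)) :
    (roundMetric y : EuclideanSpace ℝ (Fin m) →L[ℝ] EuclideanSpace ℝ (Fin m) →L[ℝ] ℝ) b d
      = (roundMetric y : EuclideanSpace ℝ (Fin m) →L[ℝ] EuclideanSpace ℝ (Fin m) →L[ℝ] ℝ) d b := by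
  let L : EuclideanSpace ℝ (Fin m) →L[ℝ] EuclideanSpace ℝ (Fin (m + 1)) :=
    mfderiv (𝓡 m) 𝓘(ℝ, EuclideanSpace ℝ (Fin (m + 1)))
      (fun q : Sph m => (q : EuclideanSpace ℝ (Fin (m + 1)))) y
  exact real_inner_comm (L d) (L b)

theorem roundMetric_nonneg (y : Sph m) (b : EuclideanSpace ℝ (Fin m)) :
    0 ≤ (roundMetric y : EuclideanSpace ℝ (Fin m) →L[ℝ] EuclideanSpace ℝ (Fin m) →L[ℝ] ℝ) b b := by
  let L : EuclideanSpace ℝ (Fin m) →L[ℝ] EuclideanSpace ℝ (Fin (m + 1)) :=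
    mfderiv (𝓡 m) 𝓘(ℝ, EuclideanSpace ℝ (Fin (m + 1)))
      (fun q : Sph m => (q : EuclideanSpace ℝ (Fin (m + 1)))) y
  exact real_inner_self_nonneg (x := L b)

theorem roundMetric_pos (y : Sph m) {b : EuclideanSpace ℝ (Fin m)} (hb : b ≠ 0) :
    0 < (roundMetric y : EuclideanSpace ℝ (Fin m) →L[ℝ] EuclideanSpace ℝ (Fin m) →L[ℝ] ℝ) b b := by
  have := Fact.mk (@finrank_euclideanSpace_fin ℝ _ (m + 1))
  let L : EuclideanSpace ℝ (Fin m) →L[ℝ] EuclideanSpace ℝ (Fin (m + 1)) :=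
    mfderiv (𝓡 m) 𝓘(ℝ, EuclideanSpace ℝ (Fin (m + 1)))
      (fun q : Sph m => (q : EuclideanSpace ℝ (Fin (m + 1)))) y
  have hL : Function.Injective L := injective_mvfderiv_subtypeVal_sphere y
  have h0 : L b ≠ 0 := fun h => hb (hL (h.trans (map_zero L).symm))
  exact real_inner_self_pos.2 h0

theorem doublyWarped_apply (h ψ : ℝ → ℝ) (p : EuclideanSpace ℝ (Fin n) × Sph m)
    (V W : EuclideanSpace ℝ (Fin n) × EuclideanSpace ℝ (Fin m)) :
    (doublyWarped n m h ψ p : (EuclideanSpace ℝ (Fin n) × EuclideanSpace ℝ (Fin m)) →L[ℝ]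
      (EuclideanSpace ℝ (Fin n) × EuclideanSpace ℝ (Fin m)) →L[ℝ] ℝ) V W
      = polarMetric h p.1 V.1 W.1 + ψ ‖p.1‖ ^ 2 *
        (roundMetric p.2 : EuclideanSpace ℝ (Fin m) →L[ℝ] EuclideanSpace ℝ (Fin m) →L[ℝ] ℝ)
          V.2 W.2 := rfl

theorem doublyWarped_symm (h ψ : ℝ → ℝ) (p : EuclideanSpace ℝ (Fin n) × Sph m)
    (V W : TangentSpace (model n m) p) :
    doublyWarped n m h ψ p V W = doublyWarped n m h ψ p W V := by
  refine (doublyWarped_apply h ψ p V W).trans (Eq.trans ?_ (doublyWarped_apply h ψ p W V).symm)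
  rw [polarMetric_symm]
  congr 2
  exact roundMetric_symm _ _ _

theorem doublyWarped_pos {h ψ : ℝ → ℝ} {p : EuclideanSpace ℝ (Fin n) × Sph m}
    (hh : p.1 ≠ 0 → h ‖p.1‖ ≠ 0) (hψ : ψ ‖p.1‖ ≠ 0) (V : TangentSpace (model n m) p) (hV : V ≠ 0) :
    0 < doublyWarped n m h ψ p V V := by
  have key : ∀ V : EuclideanSpace ℝ (Fin n) × EuclideanSpace ℝ (Fin m), V ≠ 0 →
      0 < polarMetric h p.1 V.1 V.1 + ψ ‖p.1‖ ^ 2 *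
        (roundMetric p.2 : EuclideanSpace ℝ (Fin m) →L[ℝ] EuclideanSpace ℝ (Fin m) →L[ℝ] ℝ)
          V.2 V.2 := by
    rintro ⟨a, b⟩ hab
    have hψ2 : 0 < ψ ‖p.1‖ ^ 2 := by positivity
    by_cases ha : a = 0
    · have hb : b ≠ 0 := fun hb => hab (by rw [ha, hb]; rfl)
      simpa [ha] using mul_pos hψ2 (roundMetric_pos p.2 hb)
    · exact add_pos_of_pos_of_nonneg (polarMetric_pos hh ha)
        (mul_nonneg hψ2.le (roundMetric_nonneg p.2 b))
  exact (key V hV).trans_eq (doublyWarped_apply h ψ p V V).symm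

end Positivity

section ScalarCurvature

variable {n m : ℕ}

theorem scalarCurvature_doublyWarped {h ψ : ℝ → ℝ} {p : EuclideanSpace ℝ (Fin n) × Sph m}
    (hp : p.1 ≠ 0) (hd : ContDiff ℝ ∞ h) (hψd : ContDiff ℝ ∞ ψ) (hh : h ‖p.1‖ ≠ 0)
    (hψ : ψ ‖p.1‖ ≠ 0) :
    scalarCurvature (doublyWarped n m h ψ) p = warpedScal n m h ψ ‖p.1‖ := by
  have hr : 0 < ‖p.1‖ := norm_pos_iff.2 hp
  obtain ⟨i₀⟩ : Nonempty (Fin n) := by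
    by_contra hne
    rw [not_nonempty_iff] at hne
    exact hp (Subsingleton.elim _ _)
  obtain ⟨b₁, hb₁⟩ : ∃ b₁ : OrthonormalBasis (Fin n) ℝ (EuclideanSpace ℝ (Fin n)),
      b₁ i₀ = ‖p.1‖⁻¹ • p.1 := by
    obtain ⟨b, hb⟩ := Orthonormal.exists_orthonormalBasis_extension_of_card_eq (𝕜 := ℝ)
      (E := EuclideanSpace ℝ (Fin n)) (ι := Fin n) (by simp) (v := fun _ => ‖p.1‖⁻¹ • p.1)
      (s := {i₀}) (by
        constructor
        · intro i
          simp [Set.domRestrict, norm_smul, hr.ne']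
        · intro i j hij
          exact (hij (Subsingleton.elim _ _)).elim)
    exact ⟨b, hb i₀ rfl⟩
  have hz : extChartAt (model n m) p p = (‖p.1‖ • b₁ i₀, (0 : EuclideanSpace ℝ (Fin m))) := by
    rw [hb₁, smul_smul, mul_inv_cancel₀ hr.ne', one_smul]
    exact extChartAt_model_self p
  have hz0 : ‖p.1‖ • b₁ i₀ ≠ 0 := by
    rw [hb₁, smul_smul, mul_inv_cancel₀ hr.ne', one_smul]; exact hp
  have hsm : ContDiffAt ℝ ∞ (inChart (doublyWarped n m h ψ) p) (‖p.1‖ • b₁ i₀, 0) := by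
    have h1 := contDiffAt_inChart_of_ne (H := fun _ => h) (ψ := ψ)
      (hd.comp contDiff_snd) hψd p 0 (z := (‖p.1‖ • b₁ i₀, 0)) hz0
    exact h1.comp (‖p.1‖ • b₁ i₀, (0 : EuclideanSpace ℝ (Fin m)))
      (contDiffAt_const.prodMk contDiffAt_id)
  have hev : ∀ᶠ y in nhds (‖p.1‖ • b₁ i₀, (0 : EuclideanSpace ℝ (Fin m))),
      ∀ V W, inChart (doublyWarped n m h ψ) p y V W = warpedForm h ψ y V W := by
    filter_upwards [continuous_fst.continuousAt.eventually_ne hz0] with y hy V W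
    rw [inChart_doublyWarped, polarMetric_apply hy, warpedForm, isoForm]
    ring
  have := coordScalarCurvature_warped b₁ (EuclideanSpace.basisFun (Fin m) ℝ) i₀ hr hd hψd hh hψ
    hsm hev
  rw [scalarCurvature, hz]
  simpa using this

theorem scalarCurvature_doublyWarped_congr {h h' ψ : ℝ → ℝ} {ε : ℝ}
    {p : EuclideanSpace ℝ (Fin n) × Sph m} (hp : ‖p.1‖ < ε) (hh : ∀ r ∈ Ico 0 ε, h r = h' r) :
    scalarCurvature (doublyWarped n m h ψ) p = scalarCurvature (doublyWarped n m h' ψ) p := by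
  refine coordScalarCurvature_congr ?_
  rw [extChartAt_model_self]
  have hc : Continuous fun z : EuclideanSpace ℝ (Fin n) × EuclideanSpace ℝ (Fin m) => ‖z.1‖ := by
    fun_prop
  filter_upwards [hc.continuousAt.eventually_lt_const (by exact hp)] with z hz
  refine ContinuousLinearMap.ext fun V => ContinuousLinearMap.ext fun W => ?_
  rw [inChart_doublyWarped, inChart_doublyWarped,
    polarMetric_congr (hh _ ⟨norm_nonneg _, hz⟩)]

end ScalarCurvature

section Profile

/-- A smooth nonincreasing function which is `1` on `(-∞, 1]` and `0` on `[2, ∞)`. -/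
def cutoff (t : ℝ) : ℝ := Real.smoothTransition (2 - t)

theorem contDiff_cutoff : ContDiff ℝ ∞ cutoff :=
  Real.smoothTransition.contDiff.comp (contDiff_const.sub contDiff_id)

theorem continuous_cutoff : Continuous cutoff := contDiff_cutoff.continuous

theorem antitone_cutoff : Antitone cutoff := fun _ _ h =>
  Real.smoothTransition.monotone (sub_le_sub_left h 2)

theorem cutoff_nonneg (t : ℝ) : 0 ≤ cutoff t := Real.smoothTransition.nonneg _

theorem cutoff_le_one (t : ℝ) : cutoff t ≤ 1 := Real.smoothTransition.le_one _

theorem cutoff_of_le_one {t : ℝ} (ht : t ≤ 1) : cutoff t = 1 :=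
  Real.smoothTransition.one_of_one_le (by linarith)

theorem cutoff_of_two_le {t : ℝ} (ht : 2 ≤ t) : cutoff t = 0 :=
  Real.smoothTransition.zero_of_nonpos (by linarith)

/-- The primitive of `cutoff`: the identity on `(-∞, 1]`, constant on `[2, ∞)`. -/
def flatten (x : ℝ) : ℝ := ∫ t in (0 : ℝ)..x, cutoff t

theorem hasDerivAt_flatten (x : ℝ) : HasDerivAt flatten (cutoff x) x :=
  intervalIntegral.integral_hasDerivAt_right (continuous_cutoff.intervalIntegrable _ _)
    (continuous_cutoff.stronglyMeasurableAtFilter _ _) continuous_cutoff.continuousAt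

theorem deriv_flatten : deriv flatten = cutoff := funext fun x => (hasDerivAt_flatten x).deriv

theorem contDiff_flatten : ContDiff ℝ ∞ flatten := by
  rw [contDiff_infty_iff_deriv, deriv_flatten]
  exact ⟨fun x => (hasDerivAt_flatten x).differentiableAt, contDiff_cutoff⟩

theorem flatten_of_le_one {x : ℝ} (hx : x ≤ 1) : flatten x = x := by
  have : ∫ t in (0 : ℝ)..x, cutoff t = ∫ _t in (0 : ℝ)..x, (1 : ℝ) := by
    refine intervalIntegral.integral_congr fun t ht => ?_
    refine cutoff_of_le_one (ht.2.trans ?_)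
    simp [hx]
  rw [flatten, this]
  simp

theorem flatten_of_two_le {x : ℝ} (hx : 2 ≤ x) : flatten x = flatten 2 := by
  have h1 := intervalIntegral.integral_add_adjacent_intervals
    (continuous_cutoff.intervalIntegrable (μ := MeasureTheory.volume) 0 2)
    (continuous_cutoff.intervalIntegrable 2 x)
  have h2 : ∫ t in (2 : ℝ)..x, cutoff t = ∫ _t in (2 : ℝ)..x, (0 : ℝ) := by
    refine intervalIntegral.integral_congr fun t ht => ?_
    rw [uIcc_of_le hx] at ht
    exact cutoff_of_two_le ht.1
  rw [flatten, ← h1, h2]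
  simp [flatten]

theorem monotone_flatten : Monotone flatten :=
  monotone_of_deriv_nonneg (fun x => (hasDerivAt_flatten x).differentiableAt) fun x => by
    rw [deriv_flatten]; exact cutoff_nonneg x

theorem one_le_flatten_two : 1 ≤ flatten 2 := by
  have := monotone_flatten (show (1 : ℝ) ≤ 2 by norm_num)
  rwa [flatten_of_le_one le_rfl] at this

theorem flatten_two_le_two : flatten 2 ≤ 2 := by
  have h : AntitoneOn (fun x => flatten x - x) (Ici 0) := by
    refine antitoneOn_of_deriv_nonpos (convex_Ici 0)
      (contDiff_flatten.continuous.sub continuous_id).continuousOn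
      (fun x _ => ((hasDerivAt_flatten x).sub
        (hasDerivAt_id x)).differentiableAt.differentiableWithinAt)
      fun x _ => ?_
    have := ((hasDerivAt_flatten x).sub (hasDerivAt_id x)).deriv
    rw [show (fun x => flatten x - x) = flatten - id from rfl, this]
    linarith [cutoff_le_one x]
  have h2 := h (show (0 : ℝ) ∈ Ici 0 by simp) (show (2 : ℝ) ∈ Ici 0 by simp) (by norm_num)
  simp only [flatten_of_le_one zero_le_one] at h2
  linarith

/-- The sine function near `0`, bent to the constant `c`. -/
def bentSin (b c r : ℝ) : ℝ :=
  if r < b then c / flatten 2 * flatten (flatten 2 * Real.sin r / c) else c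

variable {b c : ℝ}

theorem bentSin_of_lt {r : ℝ} (hr : r < b) :
    bentSin b c r = c / flatten 2 * flatten (flatten 2 * Real.sin r / c) := if_pos hr

theorem bentSin_eq_sin (hc : 0 < c) {r : ℝ} (hr0 : 0 ≤ r) (hr : r ≤ c / 2) (hrb : r < b) :
    bentSin b c r = Real.sin r := by
  have hK : 0 < flatten 2 := one_pos.trans_le one_le_flatten_two
  have hs : Real.sin r ≤ r := Real.sin_le hr0
  have hle : flatten 2 * Real.sin r / c ≤ 1 := by
    rw [div_le_one hc]
    nlinarith [flatten_two_le_two]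
  rw [bentSin_of_lt hrb, flatten_of_le_one hle]
  field_simp

theorem bentSin_eq_const (hc : 0 < c) (hb : b < 1) (hcb : 2 * c ≤ Real.sin (b / 2)) (hb0 : 0 < b)
    {r : ℝ} (hr : b / 2 ≤ r) : bentSin b c r = c := by
  have hK := one_le_flatten_two
  have hpi := Real.pi_gt_three
  by_cases h : r < b
  · have hs : Real.sin (b / 2) ≤ Real.sin r :=
      Real.sin_le_sin_of_le_of_le_pi_div_two (by linarith) (by linarith) hr
    have hle : 2 ≤ flatten 2 * Real.sin r / c := by
      rw [le_div_iff₀ hc]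
      nlinarith
    rw [bentSin_of_lt h, flatten_of_two_le hle]
    field_simp
  · exact if_neg h

theorem bentSin_eventuallyEq_of_lt {r : ℝ} (hr : r < b) :
    bentSin b c =ᶠ[nhds r] fun r => c / flatten 2 * flatten (flatten 2 * Real.sin r / c) := by
  filter_upwards [Iio_mem_nhds hr] with s hs using bentSin_of_lt hs

theorem bentSin_eventuallyEq_const (hc : 0 < c) (hb : b < 1) (hcb : 2 * c ≤ Real.sin (b / 2))
    (hb0 : 0 < b) {r : ℝ} (hr : b / 2 < r) : bentSin b c =ᶠ[nhds r] fun _ => c := by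
  filter_upwards [Ioi_mem_nhds hr] with s hs using bentSin_eq_const hc hb hcb hb0 (le_of_lt hs)

theorem contDiff_bentSin (hc : 0 < c) (hb : b < 1) (hcb : 2 * c ≤ Real.sin (b / 2))
    (hb0 : 0 < b) : ContDiff ℝ ∞ (bentSin b c) := by
  rw [contDiff_iff_contDiffAt]
  intro r
  by_cases h : r < b
  · refine ContDiffAt.congr_of_eventuallyEq ?_ (bentSin_eventuallyEq_of_lt h)
    exact (contDiff_const.mul (contDiff_flatten.comp
      ((contDiff_const.mul Real.contDiff_sin).div_const c))).contDiffAt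
  · exact contDiffAt_const.congr_of_eventuallyEq
      (bentSin_eventuallyEq_const hc hb hcb hb0 (by linarith))

theorem deriv_bentSin_of_lt (hc : 0 < c) {r : ℝ} (hr : r < b) :
    deriv (bentSin b c) r = cutoff (flatten 2 * Real.sin r / c) * Real.cos r := by
  have hK : 0 < flatten 2 := one_pos.trans_le one_le_flatten_two
  rw [(bentSin_eventuallyEq_of_lt hr).deriv_eq]
  have h1 := ((Real.hasDerivAt_sin r).const_mul (flatten 2)).div_const c
  have h2 := ((hasDerivAt_flatten _).comp r h1).const_mul (c / flatten 2)
  refine h2.deriv.trans ?_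
  field_simp

theorem deriv_bentSin_mem (hc : 0 < c) (hb : b < 1) (hcb : 2 * c ≤ Real.sin (b / 2))
    (hb0 : 0 < b) {r : ℝ} (hr : 0 ≤ r) : deriv (bentSin b c) r ∈ Icc (0 : ℝ) 1 := by
  have hpi := Real.pi_gt_three
  by_cases h : r < b
  · rw [deriv_bentSin_of_lt hc h]
    have hcos : 0 ≤ Real.cos r :=
      Real.cos_nonneg_of_neg_pi_div_two_le_of_le (by linarith) (by linarith)
    exact ⟨mul_nonneg (cutoff_nonneg _) hcos,
      mul_le_one₀ (cutoff_le_one _) hcos (Real.cos_le_one _)⟩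
  · rw [(bentSin_eventuallyEq_const hc hb hcb hb0 (by linarith)).deriv_eq]
    simp

theorem deriv_deriv_bentSin_nonpos (hc : 0 < c) (hb : b < 1) (hcb : 2 * c ≤ Real.sin (b / 2))
    (hb0 : 0 < b) {r : ℝ} (hr : 0 ≤ r) : deriv (deriv (bentSin b c)) r ≤ 0 := by
  have hpi := Real.pi_gt_three
  have hK : 0 < flatten 2 := one_pos.trans_le one_le_flatten_two
  by_cases h : r < b
  · have hev : deriv (bentSin b c) =ᶠ[nhds r]
        fun r => cutoff (flatten 2 * Real.sin r / c) * Real.cos r := by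
      filter_upwards [Iio_mem_nhds h] with s hs using deriv_bentSin_of_lt hc hs
    rw [hev.deriv_eq]
    have h1 := ((Real.hasDerivAt_sin r).const_mul (flatten 2)).div_const c
    have hcd : HasDerivAt cutoff _ (flatten 2 * Real.sin r / c) :=
      (contDiff_cutoff.differentiable (by simp) _).hasDerivAt
    have h2 := (hcd.comp r h1).mul (Real.hasDerivAt_cos r)
    refine h2.deriv.trans_le ?_
    have hcos : 0 ≤ Real.cos r :=
      Real.cos_nonneg_of_neg_pi_div_two_le_of_le (by linarith) (by linarith)
    have hsin : 0 ≤ Real.sin r := Real.sin_nonneg_of_nonneg_of_le_pi hr (by linarith)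
    have hd : deriv cutoff (flatten 2 * Real.sin r / c) ≤ 0 := antitone_cutoff.deriv_nonpos
    have t1 : deriv cutoff (flatten 2 * Real.sin r / c) * (flatten 2 * Real.cos r / c)
        * Real.cos r ≤ 0 :=
      mul_nonpos_of_nonpos_of_nonneg (mul_nonpos_of_nonpos_of_nonneg hd (by positivity)) hcos
    have t2 : 0 ≤ cutoff (flatten 2 * Real.sin r / c) * Real.sin r :=
      mul_nonneg (cutoff_nonneg _) hsin
    simp only [Function.comp_apply]
    linarith
  · have hlt : b / 2 < r := by linarith
    have h1 : deriv (bentSin b c) =ᶠ[nhds r] fun _ => 0 := by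
      filter_upwards [(bentSin_eventuallyEq_const hc hb hcb hb0 hlt).eventuallyEq_nhds] with s hs
      rw [hs.deriv_eq]; simp
    rw [h1.deriv_eq]
    simp

theorem concaveOn_bentSin (hc : 0 < c) (hb : b < 1) (hcb : 2 * c ≤ Real.sin (b / 2))
    (hb0 : 0 < b) : ConcaveOn ℝ (Ici 0) (bentSin b c) := by
  have hs := contDiff_bentSin hc hb hcb hb0
  refine concaveOn_of_deriv2_nonpos (convex_Ici 0) hs.continuous.continuousOn
    (hs.differentiable (by simp)).differentiableOn
    ((contDiff_infty_iff_deriv.1 hs).2.differentiable (by simp)).differentiableOn fun r hr => ?_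
  exact deriv_deriv_bentSin_nonpos hc hb hcb hb0 (interior_subset hr)

theorem bentSin_pos (hc : 0 < c) (hb : b < 1) (hcb : 2 * c ≤ Real.sin (b / 2))
    (hb0 : 0 < b) {r : ℝ} (hr : 0 < r) : 0 < bentSin b c r := by
  have hs := contDiff_bentSin hc hb hcb hb0
  have hpi := Real.pi_gt_three
  have hmono : MonotoneOn (bentSin b c) (Ici 0) :=
    monotoneOn_of_deriv_nonneg (convex_Ici 0) hs.continuous.continuousOn
      (hs.differentiable (by simp)).differentiableOn
      fun x hx => (deriv_bentSin_mem hc hb hcb hb0 (interior_subset hx)).1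
  have hm : 0 < min r (min (c / 2) (b / 2)) := by positivity
  have h1 : min r (min (c / 2) (b / 2)) ≤ c / 2 := (min_le_right _ _).trans (min_le_left _ _)
  have h2 : min r (min (c / 2) (b / 2)) ≤ b / 2 := (min_le_right _ _).trans (min_le_right _ _)
  have h3 := hmono hm.le hr.le (min_le_left r (min (c / 2) (b / 2)))
  rw [bentSin_eq_sin hc hm.le h1 (by linarith)] at h3
  exact (Real.sin_pos_of_pos_of_lt_pi hm (by linarith)).trans_le h3

end Profile

section Interpolation

/-- The interpolation between two warping functions. -/
def interp (h h' : ℝ → ℝ) (τ r : ℝ) : ℝ := (1 - τ) * h r + τ * h' r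

theorem contDiff_interp {h h' : ℝ → ℝ} (hd : ContDiff ℝ ∞ h) (hd' : ContDiff ℝ ∞ h') :
    ContDiff ℝ ∞ (fun q : ℝ × ℝ => interp h h' q.1 q.2) := by
  unfold interp
  exact ((contDiff_const.sub contDiff_fst).mul (hd.comp contDiff_snd)).add
    (contDiff_fst.mul (hd'.comp contDiff_snd))

theorem contDiff_interp_right {h h' : ℝ → ℝ} (hd : ContDiff ℝ ∞ h) (hd' : ContDiff ℝ ∞ h')
    (τ : ℝ) : ContDiff ℝ ∞ (interp h h' τ) :=
  (contDiff_interp hd hd').comp (contDiff_const.prodMk contDiff_id)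

theorem deriv_interp {h h' : ℝ → ℝ} (hd : Differentiable ℝ h) (hd' : Differentiable ℝ h')
    (τ : ℝ) : deriv (interp h h' τ) = interp (deriv h) (deriv h') τ :=
  funext fun r => (((hd r).hasDerivAt.const_mul (1 - τ)).add
    ((hd' r).hasDerivAt.const_mul τ)).deriv

theorem deriv_deriv_interp {h h' : ℝ → ℝ} (hd : ContDiff ℝ ∞ h) (hd' : ContDiff ℝ ∞ h') (τ : ℝ) :
    deriv (deriv (interp h h' τ)) = interp (deriv (deriv h)) (deriv (deriv h')) τ := by
  rw [deriv_interp (hd.differentiable (by simp)) (hd'.differentiable (by simp)),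
    deriv_interp ((contDiff_infty_iff_deriv.1 hd).2.differentiable (by simp))
      ((contDiff_infty_iff_deriv.1 hd').2.differentiable (by simp))]

/-- Scalar curvature is positive where `ψ` is constant and `h` is concave with slope in `[0, 1]`. -/
theorem warpedScal_pos_of_const {n m : ℝ} (hn : 2 ≤ n) (hm : 1 < m) {h ψ : ℝ → ℝ} {r : ℝ}
    (hh : 0 < h r) (h1 : deriv h r ∈ Icc (0 : ℝ) 1) (h2 : deriv (deriv h) r ≤ 0) (hψ : 0 < ψ r)
    (hψ1 : deriv ψ r = 0) (hψ2 : deriv (deriv ψ) r = 0) : 0 < warpedScal n m h ψ r := by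
  have t1 : 0 ≤ 2 * (n - 1) * (-deriv (deriv h) r / h r) :=
    mul_nonneg (by linarith) (div_nonneg (by linarith) hh.le)
  have t2 : 0 ≤ (n - 1) * (n - 2) * ((1 - deriv h r ^ 2) / h r ^ 2) :=
    mul_nonneg (mul_nonneg (by linarith) (by linarith))
      (div_nonneg (sub_nonneg.2 (pow_le_one₀ h1.1 h1.2)) (by positivity))
  have t3 : 0 < m * (m - 1) * ((1 - (0 : ℝ) ^ 2) / ψ r ^ 2) :=
    mul_pos (mul_pos (by linarith) (by linarith)) (by simpa using by positivity)
  rw [warpedScal, hψ1, hψ2]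
  simp only [neg_zero, zero_div, mul_zero, add_zero]
  linarith

/-- Interpolating the warping function `h` towards a sufficiently small constant does not decrease
scalar curvature. -/
theorem warpedScal_le_interp {n m : ℝ} (hn : 3 ≤ n) (hm : 0 ≤ m) {h h' ψ : ℝ → ℝ} {r τ c A H : ℝ}
    (hd : ContDiff ℝ ∞ h) (hd' : ContDiff ℝ ∞ h') (hτ : τ ∈ Icc (0 : ℝ) 1) (hc : 0 < c)
    (hh' : h' =ᶠ[nhds r] fun _ => c) (hch : 2 * c ≤ h r) (hH : h r ≤ H)
    (hA : -deriv (deriv h) r ≤ A) (h1 : 0 ≤ deriv h r)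
    (hA0 : 0 ≤ A) (hcA : 4 * A * H * c ≤ h r) (hψ : 0 < ψ r) (hψ1 : 0 ≤ deriv ψ r) :
    warpedScal n m h ψ r ≤ warpedScal n m (interp h h' τ) ψ r := by
  have e0 : h' r = c := hh'.self_of_nhds
  have ev1 : deriv h' =ᶠ[nhds r] fun _ => 0 := by
    filter_upwards [hh'.eventuallyEq_nhds] with s hs
    rw [hs.deriv_eq]; simp
  have e1 : deriv h' r = 0 := ev1.self_of_nhds
  have e2 : deriv (deriv h') r = 0 := by rw [ev1.deriv_eq]; simp
  simp only [warpedScal]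
  rw [deriv_deriv_interp hd hd', deriv_interp (hd.differentiable (by simp))
    (hd'.differentiable (by simp))]
  simp only [interp, e0, e1, e2, mul_zero, add_zero]
  obtain ⟨hτ0, hτ1⟩ := hτ
  generalize deriv (deriv h) r = d2 at *
  generalize deriv h r = d1 at *
  generalize h r = x at *
  generalize deriv ψ r = y1 at *
  generalize ψ r = y at *
  have hx : 0 < x := by linarith
  set k := (1 - τ) * x + τ * c with hk
  have hkx : k ≤ x := by nlinarith
  have hk0 : 0 < k := by nlinarith
  have hq : (1 - τ) / k ≤ 1 / x := by
    rw [div_le_div_iff₀ hk0 hx]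
    nlinarith
  have hq0 : 0 ≤ (1 - τ) / k := div_nonneg (by linarith) hk0.le
  have P1 : -d2 / x - τ * c * A / (x * k) ≤ -((1 - τ) * d2) / k := by
    have : -((1 - τ) * d2) / k - -d2 / x = -(τ * c * -d2 / (x * k)) := by
      field_simp
      rw [hk]; ring
    have h3 : τ * c * -d2 / (x * k) ≤ τ * c * A / (x * k) := by gcongr
    linarith
  have P2 : (1 - d1 ^ 2) / x ^ 2 + τ / (2 * k ^ 2) ≤ (1 - ((1 - τ) * d1) ^ 2) / k ^ 2 := by
    have h3 : ((1 - τ) * d1) ^ 2 / k ^ 2 ≤ d1 ^ 2 / x ^ 2 := by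
      have : ((1 - τ) / k * d1) ^ 2 ≤ (1 / x * d1) ^ 2 := by gcongr
      calc ((1 - τ) * d1) ^ 2 / k ^ 2 = ((1 - τ) / k * d1) ^ 2 := by field_simp
        _ ≤ (1 / x * d1) ^ 2 := this
        _ = d1 ^ 2 / x ^ 2 := by field_simp
    have h4 : 1 / x ^ 2 + τ / (2 * k ^ 2) ≤ 1 / k ^ 2 := by
      have h6 : 1 / k ^ 2 - 1 / x ^ 2 - τ / (2 * k ^ 2)
          = ((2 - τ) * x ^ 2 - 2 * k ^ 2) / (2 * k ^ 2 * x ^ 2) := by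
        field_simp
        ring
      have h7 : 0 ≤ (2 - τ) * x ^ 2 - 2 * k ^ 2 := by
        have h8 : k ≤ (1 - τ / 2) * x := by rw [hk]; nlinarith
        have h9 : k * k ≤ (1 - τ / 2) * x * x := mul_le_mul h8 hkx hk0.le (by nlinarith)
        have h11 : (2 - τ) * x ^ 2 - 2 * k ^ 2 = 2 * ((1 - τ / 2) * x * x - k * k) := by ring
        rw [h11]
        linarith
      have h10 : 0 ≤ ((2 - τ) * x ^ 2 - 2 * k ^ 2) / (2 * k ^ 2 * x ^ 2) :=
        div_nonneg h7 (by positivity)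
      linarith
    rw [sub_div, sub_div]
    linarith
  have P3 : -(d1 * y1) / (x * y) ≤ -((1 - τ) * d1 * y1) / (k * y) := by
    have h3 : (1 - τ) / k * (d1 * y1 / y) ≤ 1 / x * (d1 * y1 / y) := by gcongr
    have h4 : -(d1 * y1) / (x * y) = -(1 / x * (d1 * y1 / y)) := by field_simp
    have h5 : -((1 - τ) * d1 * y1) / (k * y) = -((1 - τ) / k * (d1 * y1 / y)) := by field_simp
    rw [h4, h5]
    linarith
  have P4 : 2 * (τ * c * A / (x * k)) ≤ τ / (2 * k ^ 2) := by
    have h3 : 4 * A * k * c ≤ x := by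
      have : 4 * A * k * c ≤ 4 * A * H * c := by gcongr; linarith
      linarith
    have h4 : τ / (2 * k ^ 2) - 2 * (τ * c * A / (x * k))
        = τ * (x - 4 * A * k * c) / (2 * k ^ 2 * x) := by
      field_simp
      ring
    have h5 : 0 ≤ τ * (x - 4 * A * k * c) / (2 * k ^ 2 * x) :=
      div_nonneg (mul_nonneg hτ0 (by linarith)) (by positivity)
    linarith
  have s0 : 0 ≤ τ / (2 * k ^ 2) := by positivity
  clear hq hq0 hkx hcA hch hk
  generalize τ * c * A / (x * k) = t at *
  generalize τ / (2 * k ^ 2) = s at *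
  generalize -d2 / x = X₁ at *
  generalize -((1 - τ) * d2) / k = Y₁ at *
  generalize (1 - d1 ^ 2) / x ^ 2 = X₂ at *
  generalize (1 - ((1 - τ) * d1) ^ 2) / k ^ 2 = Y₂ at *
  generalize -(d1 * y1) / (x * y) = X₃ at *
  generalize -((1 - τ) * d1 * y1) / (k * y) = Y₃ at *
  have n1 : 0 ≤ n - 1 := by linarith
  have Q1 := mul_le_mul_of_nonneg_left P1 (mul_nonneg zero_le_two n1)
  have Q2 := mul_le_mul_of_nonneg_left P2 (mul_nonneg n1 (show 0 ≤ n - 2 by linarith))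
  have Q3 := mul_le_mul_of_nonneg_left P3 (mul_nonneg (mul_nonneg zero_le_two hm) n1)
  have Q4 : 2 * (n - 1) * t ≤ (n - 1) * (n - 2) * s := by
    have h4 := mul_le_mul_of_nonneg_left P4 n1
    have h5 := mul_le_mul_of_nonneg_left (show 1 ≤ n - 2 by linarith) (mul_nonneg n1 s0)
    linarith
  rw [mul_sub] at Q1
  rw [mul_add] at Q2
  linarith

end Interpolation

section Existence

theorem deriv_le_one_of_concave {a b : ℝ} {h : ℝ → ℝ} (hb : 0 < b) (hba : b ≤ a)
    (hd : ContDiff ℝ ∞ h) (hsin : ∀ r ∈ Icc 0 b, h r = Real.sin r)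
    (hconc : ∀ r ∈ Icc 0 a, deriv (deriv h) r ≤ 0) {r : ℝ} (hr : 0 < r) (hra : r ≤ a) :
    deriv h r ≤ 1 := by
  have hd' := (contDiff_infty_iff_deriv.1 hd).2
  have hanti : AntitoneOn (deriv h) (Icc 0 a) :=
    antitoneOn_of_deriv_nonpos (convex_Icc 0 a) hd'.continuous.continuousOn
      (hd'.differentiable (by simp)).differentiableOn fun x hx => hconc x (interior_subset hx)
  have hs0 : 0 < min r (b / 2) := by positivity
  have hsb : min r (b / 2) < b := (min_le_right _ _).trans_lt (by linarith)
  have h1 : deriv h (min r (b / 2)) = Real.cos (min r (b / 2)) := by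
    have : h =ᶠ[nhds (min r (b / 2))] Real.sin := by
      filter_upwards [Ioo_mem_nhds hs0 hsb] with s hs using hsin s ⟨hs.1.le, hs.2.le⟩
    rw [this.deriv_eq, Real.deriv_sin]
  have h2 := hanti ⟨hs0.le, (hsb.le.trans hba)⟩ ⟨hr.le, hra⟩ (min_le_left _ _)
  rw [h1] at h2
  exact h2.trans (Real.cos_le_one _)

theorem isSmoothPSCPathOn_interp {n m : ℕ} (hn : 3 ≤ n) (hm : 2 ≤ m) {a b c A H ε C : ℝ}
    {h h' ψ : ℝ → ℝ} (hb : 0 < b) (hb4 : b < 1 / 4) (ha : 1 / 2 < a) (hc : 0 < c)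
    (hd : ContDiff ℝ ∞ h) (hd' : ContDiff ℝ ∞ h') (hψd : ContDiff ℝ ∞ ψ)
    (hsin : ∀ r ∈ Icc 0 b, h r = Real.sin r)
    (hconc : ∀ r ∈ Icc 0 a, deriv (deriv h) r ≤ 0) (hmono : ∀ r ∈ Icc 0 a, 0 ≤ deriv h r)
    (hpos : ∀ r ∈ Ioc 0 a, 0 < h r)
    (hε : 0 < ε) (hεb : ε < b) (hsin' : ∀ r ∈ Ico 0 ε, h' r = Real.sin r)
    (hconc' : ∀ r, 0 ≤ r → deriv (deriv h') r ≤ 0)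
    (hderiv' : ∀ r, 0 ≤ r → deriv h' r ∈ Icc (0 : ℝ) 1) (hpos' : ∀ r, 0 < r → 0 < h' r)
    (hconst : ∀ r, b / 2 ≤ r → h' r = c)
    (hψ : ∀ r ∈ Icc 0 a, 0 < ψ r) (hψC : ∀ r ∈ Icc 0 (1 / 4), ψ r = C)
    (hψmono : ∀ r ∈ Icc 0 a, 0 ≤ deriv ψ r)
    (hA0 : 0 ≤ A) (hA : ∀ r ∈ Icc 0 a, -deriv (deriv h) r ≤ A)
    (hH : ∀ r ∈ Icc 0 a, h r ≤ H)
    (hch : ∀ r ∈ Icc b a, 2 * c ≤ h r) (hcA : ∀ r ∈ Icc b a, 4 * A * H * c ≤ h r)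
    (hpsc : ∀ p ∈ discTimesSphere n m a, 0 < scalarCurvature (doublyWarped n m h ψ) p) :
    IsSmoothPSCPathOn (fun τ => doublyWarped n m (interp h h' τ) ψ) (discTimesSphere n m a) := by
  have hipos : ∀ τ ∈ Icc (0 : ℝ) 1, ∀ r ∈ Ioc 0 a, 0 < interp h h' τ r := by
    intro τ hτ r hr
    have h1 := hpos r hr
    have h2 := hpos' r hr.1
    have := (convex_Ioi (0 : ℝ)) h1 h2 (sub_nonneg.2 hτ.2) hτ.1 (by ring)
    simpa [interp] using this
  have hisin : ∀ τ, ∀ r ∈ Ico 0 ε, interp h h' τ r = Real.sin r := by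
    intro τ r hr
    rw [interp, hsin r ⟨hr.1, (hr.2.trans hεb).le⟩, hsin' r hr]
    ring
  refine ⟨?_, ?_, ?_, ?_⟩
  · intro τ hτ p hp
    refine ContDiffAt.contDiffWithinAt ?_
    rw [extChartAt_model_self]
    by_cases h0 : p.1 = 0
    · exact contDiffAt_inChart_of_sin hε hisin
        (fun r hr => hψC r ⟨hr.1, by linarith [hr.2]⟩) p τ h0
    · exact contDiffAt_inChart_of_ne (contDiff_interp hd hd') hψd p τ h0
  · intro τ _ p _ v w
    exact doublyWarped_symm _ _ p v w
  · intro τ hτ p hp v hv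
    exact doublyWarped_pos (fun h0 => (hipos τ hτ _ ⟨norm_pos_iff.2 h0, hp⟩).ne')
      (hψ _ ⟨norm_nonneg _, hp⟩).ne' v hv
  · intro τ hτ p hp
    by_cases h0 : p.1 = 0
    · have h1 : ‖p.1‖ < ε := by rw [h0, norm_zero]; exact hε
      rw [scalarCurvature_doublyWarped_congr (h' := h) h1 fun r hr => by
        rw [hisin τ r hr, hsin r ⟨hr.1, (hr.2.trans hεb).le⟩]]
      exact hpsc p hp
    · have hr0 : 0 < ‖p.1‖ := norm_pos_iff.2 h0
      have hra : ‖p.1‖ ≤ a := hp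
      have hn' : (3 : ℝ) ≤ n := by exact_mod_cast hn
      have hm' : (2 : ℝ) ≤ m := by exact_mod_cast hm
      have hG := hpsc p hp
      rw [scalarCurvature_doublyWarped h0 hd hψd (hpos _ ⟨hr0, hra⟩).ne'
        (hψ _ ⟨hr0.le, hra⟩).ne'] at hG
      rw [scalarCurvature_doublyWarped h0 (contDiff_interp_right hd hd' τ) hψd
        (hipos τ hτ _ ⟨hr0, hra⟩).ne' (hψ _ ⟨hr0.le, hra⟩).ne']
      generalize ‖p.1‖ = r at *
      by_cases hr4 : r < 1 / 4
      · have ev0 : ψ =ᶠ[nhds r] fun _ => C := by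
          filter_upwards [Ioo_mem_nhds hr0 hr4] with s hs using hψC s ⟨hs.1.le, hs.2.le⟩
        have ev1 : deriv ψ =ᶠ[nhds r] fun _ => 0 := by
          filter_upwards [ev0.eventuallyEq_nhds] with s hs
          rw [hs.deriv_eq]; simp
        have h1 := deriv_le_one_of_concave hb (by linarith) hd hsin hconc hr0 hra
        have h2 := hmono r ⟨hr0.le, hra⟩
        refine warpedScal_pos_of_const (by linarith) (by linarith) (hipos τ hτ r ⟨hr0, hra⟩) ?_ ?_
          (hψ r ⟨hr0.le, hra⟩) ev1.self_of_nhds (by rw [ev1.deriv_eq]; simp)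
        · rw [deriv_interp (hd.differentiable (by simp)) (hd'.differentiable (by simp))]
          have := (convex_Icc (0 : ℝ) 1) ⟨h2, h1⟩ (hderiv' r hr0.le) (sub_nonneg.2 hτ.2) hτ.1
            (by ring)
          simpa [interp] using this
        · rw [deriv_deriv_interp hd hd']
          have := (convex_Iic (0 : ℝ)) (hconc r ⟨hr0.le, hra⟩) (hconc' r hr0.le)
            (sub_nonneg.2 hτ.2) hτ.1 (by ring)
          simpa [interp] using this
      · have hbr : b ≤ r := by linarith
        have ev : h' =ᶠ[nhds r] fun _ => c := by
          filter_upwards [Ioi_mem_nhds (show b / 2 < r by linarith)] with s hs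
            using hconst s (le_of_lt hs)
        have hrI : r ∈ Icc 0 a := ⟨hr0.le, hra⟩
        exact hG.trans_le (warpedScal_le_interp hn' (by linarith) hd hd' hτ hc ev
          (hch r ⟨hbr, hra⟩) (hH r hrI) (hA r hrI) (hmono r hrI) hA0 (hcA r ⟨hbr, hra⟩)
          (hψ r hrI) (hψmono r hrI))

end Existence

end PSC

end

theorem lemma4 (R' : ℝ) (hR'_pos : 0 < R') (hR'_lt : R' < 1 / 4) :
    ∃ δ : ℝ → ℝ,
      ∀ (n m : ℕ), 3 ≤ m + 1 → m + 1 ≤ n →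
      ∀ (a k α : ℝ) (h f : ℝ → ℝ),
        1 / 2 < a → 0 < k → 0 < α →
        ContDiff ℝ ∞ h →
        (∀ r ∈ Set.Icc 0 R', h r = Real.sin r) →
        (∀ r ∈ Set.Icc 0 a, deriv (deriv h) r ≤ 0) →
        (∀ r ∈ Set.Icc 0 a, 0 ≤ deriv h r) →
        ContDiff ℝ ∞ f →
        (∀ r ∈ Set.Icc 0 (1 / 4), f r = 1) →
        (∀ r ∈ Set.Icc 0 a, 0 ≤ deriv f r) →
        (∀ p ∈ PSC.discTimesSphere n m a,
          0 < PSC.scalarCurvature (PSC.surgeryMetric n m k α f h) p) →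
        ∃ c₀ : ℝ, 0 < c₀ ∧ ∀ c : ℝ, 0 < c → c < c₀ →
          0 < δ c ∧ δ c < R' ∧
          ∃ (hInf : ℝ → ℝ)
            (γ : ℝ → PSC.TwoTensor (PSC.model n m) (EuclideanSpace ℝ (Fin n) × PSC.Sph m)),
            ContDiff ℝ ∞ hInf ∧
            ConcaveOn ℝ (Set.Ici 0) hInf ∧
            (∀ r ∈ Set.Icc 0 (δ c), hInf r = Real.sin r) ∧
            (∀ r, R' < r → hInf r = c) ∧
            PSC.IsSmoothPSCPathOn γ (PSC.discTimesSphere n m a) ∧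
            (∀ p ∈ PSC.discTimesSphere n m a,
              γ 0 p = PSC.surgeryMetric n m k α f h p) ∧
            (∀ p ∈ PSC.discTimesSphere n m a,
              γ 1 p = PSC.surgeryMetric n m k α f hInf p) ∧
            (∀ τ ∈ Set.Icc (0 : ℝ) 1, ∀ p ∈ PSC.discTimesSphere n m (δ c),
              γ τ p = PSC.surgeryMetric n m k α f h p) := by

  refine ⟨fun c => c / 2, ?_⟩
  intro n m hm hmn a k α h f ha hk hα hd hsin hconc hmono hfd hf1 hfmono hpsc
  have hpi := Real.pi_gt_three
  have hd2 := (contDiff_infty_iff_deriv.1 (contDiff_infty_iff_deriv.1 hd).2).2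
  have hhmono : MonotoneOn h (Set.Icc 0 a) :=
    monotoneOn_of_deriv_nonneg (convex_Icc 0 a) hd.continuous.continuousOn
      (hd.differentiable (by simp)).differentiableOn fun x hx => hmono x (interior_subset hx)
  have hfmonoOn : MonotoneOn f (Set.Icc 0 a) :=
    monotoneOn_of_deriv_nonneg (convex_Icc 0 a) hfd.continuous.continuousOn
      (hfd.differentiable (by simp)).differentiableOn fun x hx => hfmono x (interior_subset hx)
  have hmin : 0 < Real.sin R' := Real.sin_pos_of_pos_of_lt_pi hR'_pos (by linarith)
  have hRh : h R' = Real.sin R' := hsin R' ⟨hR'_pos.le, le_rfl⟩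
  have hlow : ∀ r ∈ Set.Icc R' a, Real.sin R' ≤ h r := fun r hr =>
    hRh ▸ hhmono ⟨hR'_pos.le, by linarith⟩ ⟨hR'_pos.le.trans hr.1, hr.2⟩ hr.1
  have hH : ∀ r ∈ Set.Icc 0 a, h r ≤ h a := fun r hr => hhmono hr ⟨by linarith, le_rfl⟩ hr.2
  have hH0 : 0 < h a := hmin.trans_le (hlow a ⟨by linarith, le_rfl⟩)
  obtain ⟨A, hA⟩ : ∃ A, ∀ r ∈ Set.Icc 0 a, -deriv (deriv h) r ≤ A := by
    obtain ⟨A, hA⟩ := (isCompact_Icc (a := (0 : ℝ)) (b := a)).exists_bound_of_continuousOn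
      hd2.continuous.continuousOn
    exact ⟨A, fun r hr => (neg_le_abs _).trans (hA r hr)⟩
  have hA0 : 0 ≤ A := (neg_nonneg.2 (hconc 0 ⟨le_rfl, by linarith⟩)).trans
    (hA 0 ⟨le_rfl, by linarith⟩)
  have hpos : ∀ r ∈ Set.Ioc 0 a, 0 < h r := by
    intro r hr
    by_cases hrR : r ≤ R'
    · rw [hsin r ⟨hr.1.le, hrR⟩]
      exact Real.sin_pos_of_pos_of_lt_pi hr.1 (by linarith)
    · exact hmin.trans_le (hlow r ⟨by linarith, hr.2⟩)
  have hf : ∀ r ∈ Set.Icc 0 a, 1 ≤ f r := fun r hr =>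
    hf1 0 ⟨le_rfl, by norm_num⟩ ▸ hfmonoOn ⟨le_rfl, by linarith⟩ hr hr.1
  have hs2 : 0 < Real.sin (R' / 2) := Real.sin_pos_of_pos_of_lt_pi (by linarith) (by linarith)
  refine ⟨min (Real.sin (R' / 2) / 2) (min (Real.sin R' / 2) (Real.sin R' / (4 * (A + 1) * h a))),
    by positivity, fun c hc hc₀ => ?_⟩
  have c1 : 2 * c ≤ Real.sin (R' / 2) := by
    have := hc₀.trans_le (min_le_left _ _)
    linarith
  have c2 : 2 * c ≤ Real.sin R' := by
    have := hc₀.trans_le ((min_le_right _ _).trans (min_le_left _ _))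
    linarith
  have c3 : 4 * A * h a * c ≤ Real.sin R' := by
    have := hc₀.trans_le ((min_le_right _ _).trans (min_le_right _ _))
    rw [lt_div_iff₀ (by positivity)] at this
    have h2 : 0 ≤ 4 * h a * c := by positivity
    nlinarith
  have hsle : Real.sin (R' / 2) ≤ R' / 2 := Real.sin_le (by linarith)
  have hR1 : R' < 1 := by linarith
  have hψd : ContDiff ℝ ∞ (fun r => k * (f r + α)) :=
    contDiff_const.mul (hfd.add contDiff_const)
  have hδR : c / 2 < R' := by linarith
  refine ⟨by positivity, hδR, PSC.bentSin R' c,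
    fun τ => PSC.doublyWarped n m (PSC.interp h (PSC.bentSin R' c) τ) (fun r => k * (f r + α)),
    PSC.contDiff_bentSin hc hR1 c1 hR'_pos, PSC.concaveOn_bentSin hc hR1 c1 hR'_pos,
    fun r hr => PSC.bentSin_eq_sin hc hr.1 hr.2 (hr.2.trans_lt hδR),
    fun r hr => PSC.bentSin_eq_const hc hR1 c1 hR'_pos (by linarith), ?_, ?_, ?_, ?_⟩
  · refine PSC.isSmoothPSCPathOn_interp (A := A) (H := h a) (ε := c / 2) (C := k * (1 + α))
      (by omega) (by omega) hR'_pos hR'_lt ha hc hd (PSC.contDiff_bentSin hc hR1 c1 hR'_pos) hψd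
      hsin hconc hmono hpos (by positivity) hδR
      (fun r hr => PSC.bentSin_eq_sin hc hr.1 hr.2.le (hr.2.trans hδR))
      (fun r hr => PSC.deriv_deriv_bentSin_nonpos hc hR1 c1 hR'_pos hr)
      (fun r hr => PSC.deriv_bentSin_mem hc hR1 c1 hR'_pos hr)
      (fun r hr => PSC.bentSin_pos hc hR1 c1 hR'_pos hr)
      (fun r hr => PSC.bentSin_eq_const hc hR1 c1 hR'_pos hr)
      (fun r hr => mul_pos hk (by linarith [hf r hr]))
      (fun r hr => by rw [hf1 r hr]) (fun r hr => ?_) hA0 hA hH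
      (fun r hr => c2.trans (hlow r hr)) (fun r hr => c3.trans (hlow r hr)) hpsc
    have := (((hfd.differentiable (by simp) r).hasDerivAt.add_const α).const_mul k).deriv
    rw [this]
    exact mul_nonneg hk.le (hfmono r hr)
  · intro p _
    exact PSC.doublyWarped_congr (by simp [PSC.interp])
  · intro p _
    exact PSC.doublyWarped_congr (by simp [PSC.interp])
  · intro τ _ p hp
    refine PSC.doublyWarped_congr ?_
    have hp' : ‖p.1‖ ≤ c / 2 := hp
    rw [PSC.interp, PSC.bentSin_eq_sin hc (norm_nonneg _) hp' (hp'.trans_lt hδR),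
      hsin _ ⟨norm_nonneg _, (hp'.trans_lt hδR).le⟩]
    ring
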